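/- Let $n\ge 2$ and let $\Omega\subset\mathbb R^n$ be a bounded domain. Let $\gamma,\beta,\theta:\Omega\to[1,\infty)$ be measurable and essentially bounded, with $\gamma,\beta\in C^1(\overline\Omega)$ (that is, they are $C^1$ in $\Omega$ and extend continuously to $\overline\Omega$ together with their first derivatives), and suppose that for some $\varepsilon_0>0$, $\theta(x)\ge\gamma(x)+\beta(x)+\varepsilon_0$ for a.e. $x\in\Omega$. For a measurable, essentially bounded exponent $p\ge 1$ put $\sigma_p(f)=\int_\Omega|f|^{p(x)}dx$ and $\|f\|_{L^{p(x)}(\Omega)}=\inf\{\lambda>0:\sigma_p(f/\lambda)\le1\}$, and let $L^{p(x)}(\Omega)$ be the set of measurable $f:\Omega\to\mathbb R$ with $\sigma_p(f)<\infty$. For $u\in L^1(\Omega)$ the derivative $D_iu$ is understood in the generalized (truncation) sense: it is a measurable function $g$ with $g=0$ a.e. on $\{u=0\}$ such that, for every $G\in C^1(\mathbb R)$ whose derivative $G'$ has compact support in $\mathbb R\setminus\{0\}$, the function $G'(u)\,g$ is locally integrable in $\Omega$ and is the weak $i$-th partial derivative of $G(u)$. Such a $g$ is unique a.e. if it exists,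 and it is the weak derivative of $u$ whenever the latter is a locally integrable function. Functions that agree a.e. are identified. Let $$S_{1,\gamma(x),\beta(x),\theta(x)}(\Omega)=\Big\{u\in L^1(\Omega): D_1u,\dots,D_nu\text{ exist},\ \int_\Omega|u|^{\gamma(x)+\beta(x)}dx+\sum_{i=1}^n\int_\Omega|u|^{\gamma(x)}|D_iu|^{\beta(x)}dx<\infty\Big\}\cap L^{\theta(x)}(\Omega).$$ Let $\varphi(x,t)=|t|^{\gamma(x)/\beta(x)}t$, $\varphi'_t(x,t)=\big(\tfrac{\gamma(x)}{\beta(x)}+1\big)|t|^{\gamma(x)/\beta(x)}$, write $\varphi(u)=\varphi(x,u(x))$ and $\varphi'_t(u)=\varphi'_t(x,u(x))$, and let $\psi(x)=\dfrac{\theta(x)\beta(x)}{\gamma(x)+\beta(x)}$. Then $$d_{S_1}(u,v)=\|\varphi(u)-\varphi(v)\|_{L^{\psi(x)}(\Omega)}+\sum_{i=1}^n\|\varphi'_t(u)D_iu-\varphi'_t(v)D_iv\|_{L^{\beta(x)}(\Omega)}$$ is finite for all $u,v\in S_{1,\gamma(x),\beta(x),\theta(x)}(\Omega)$, and it is a metric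 under which $S_{1,\gamma(x),\beta(x),\theta(x)}(\Omega)$ is a complete metric space. -/

import Mathlib

open MeasureTheory Set
open scoped ENNReal ContDiff

noncomputable section

namespace VarExp

/-- Euclidean space `ℝⁿ`. -/
abbrev E (n : ℕ) : Type := EuclideanSpace ℝ (Fin n)

variable {n : ℕ}

/-- `p ∈ M₀(Ω)`: a measurable exponent on `Ω` with `1 ≤ p ≤ p⁺ < ∞` almost everywhere. -/
structure IsExponent (Ω : Set (E n)) (p : E n → ℝ) : Prop where
  aemeasurable : AEMeasurable p (volume.restrict Ω)
  one_le : ∀ᵐ x ∂volume.restrict Ω, 1 ≤ p x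
  bounded : ∃ C : ℝ, ∀ᵐ x ∂volume.restrict Ω, p x ≤ C

/-- `f ∈ C¹(closure Ω)` for an open set `Ω`: `f` is `C¹` in `Ω`, and `f` and its derivative extend
continuously from `Ω` to the closure of `Ω`. -/
structure IsC1Closure (Ω : Set (E n)) (f : E n → ℝ) : Prop where
  contDiffOn : ContDiffOn ℝ 1 f Ω
  extends_fun : ∃ F : E n → ℝ, ContinuousOn F (closure Ω) ∧ EqOn F f Ω
  extends_deriv : ∃ F : E n → (E n →L[ℝ] ℝ), ContinuousOn F (closure Ω) ∧ EqOn F (fderiv ℝ f) Ω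

/-- The modular `σ_p(f) = ∫_Ω |f(x)|^{p(x)} dx ∈ [0, ∞]`. -/
def modular (Ω : Set (E n)) (p f : E n → ℝ) : ℝ≥0∞ :=
  ∫⁻ x in Ω, ENNReal.ofReal (|f x| ^ p x)

/-- The Luxemburg norm `inf {l > 0 : σ_p(f / l) ≤ 1} ∈ [0, ∞]`, with `inf ∅ = ∞`. -/
def luxNorm (Ω : Set (E n)) (p f : E n → ℝ) : ℝ≥0∞ :=
  ⨅ (l : ℝ) (_ : 0 < l) (_ : modular Ω p (fun x => f x / l) ≤ 1), ENNReal.ofReal l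

/-- `f ∈ L^{p(x)}(Ω)`. -/
def MemLebesgue (Ω : Set (E n)) (p f : E n → ℝ) : Prop :=
  AEMeasurable f (volume.restrict Ω) ∧ modular Ω p f < ⊤

/-- `g ∈ L¹_loc(Ω)` is the weak (distributional) `i`-th partial derivative of `f ∈ L¹_loc(Ω)`. -/
structure IsWeakPartial (Ω : Set (E n)) (f : E n → ℝ) (i : Fin n) (g : E n → ℝ) : Prop where
  locInt_fun : LocallyIntegrableOn f Ω
  locInt_deriv : LocallyIntegrableOn g Ω
  integral_eq : ∀ η : E n → ℝ, ContDiff ℝ ∞ η → HasCompactSupport η → tsupport η ⊆ Ω →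
    ∫ x in Ω, f x * fderiv ℝ η x (EuclideanSpace.single i 1) = -∫ x in Ω, g x * η x

/-- `g` is the generalized `i`-th partial derivative `D_i u` of `u`, in the truncation sense:
every truncation `G ∘ u`, where `G` is `C¹` and `G'` has compact support in `ℝ \ {0}`, has the weak
derivative `G'(u) g`; and `g = 0` a.e. where `u = 0` (as holds for weak derivatives).
This is the weak derivative of `u` when that is a locally integrable function. It makes sense of
`D_i u` also for functions such as `u = |v|^{-s} v` with `0 < s < 1` and `v` weakly differentiable,
whose derivative need not be integrable near the zero set of `u`. -/
structure IsGenPartial (Ω : Set (E n)) (u : E n → ℝ) (i : Fin n) (g : E n → ℝ) : Prop where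
  aemeasurable : AEMeasurable g (volume.restrict Ω)
  eq_zero : ∀ᵐ x ∂volume.restrict Ω, u x = 0 → g x = 0
  truncation : ∀ G : ℝ → ℝ, ContDiff ℝ 1 G → HasCompactSupport (deriv G) →
    (0 : ℝ) ∉ tsupport (deriv G) →
    IsWeakPartial Ω (fun x => G (u x)) i (fun x => deriv G (u x) * g x)

lemma exists_truncation {q : ℝ} (hq : q ≠ 0) : ∃ G : ℝ → ℝ, ContDiff ℝ 1 G ∧
    HasCompactSupport (deriv G) ∧ (0 : ℝ) ∉ tsupport (deriv G) ∧
    ∀ t, |t - q| ≤ |q| / 4 → deriv G t = 1 := by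
  have hq' : 0 < |q| := abs_pos.mpr hq
  let b : ContDiffBump q := ⟨|q| / 4, |q| / 2, by positivity, by linarith⟩
  have hd : deriv (fun t => ∫ s in (0 : ℝ)..t, b s) = b := by
    funext t
    exact b.continuous.deriv_integral _ 0 t
  refine ⟨fun t => ∫ s in (0 : ℝ)..t, b s, ?_, ?_, ?_, ?_⟩
  · rw [contDiff_one_iff_deriv]
    refine ⟨fun t => ?_, by rw [hd]; exact b.continuous⟩
    exact (b.continuous.integral_hasStrictDerivAt 0 t).hasDerivAt.differentiableAt
  · rw [hd]; exact b.hasCompactSupport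
  · rw [hd, b.tsupport_eq]
    simp only [Metric.mem_closedBall, dist_zero_left, Real.norm_eq_abs, b]
    linarith
  · intro t ht
    rw [hd]
    exact b.one_of_mem_closedBall (by simpa [Real.dist_eq, b] using ht)

lemma IsWeakPartial.ae_eq {Ω : Set (E n)} (hΩ : IsOpen Ω) {f : E n → ℝ} {i : Fin n}
    {g h : E n → ℝ} (hg : IsWeakPartial Ω f i g) (hh : IsWeakPartial Ω f i h) :
    ∀ᵐ x ∂volume.restrict Ω, g x = h x := by
  have key : ∀ᵐ x ∂volume, x ∈ Ω → g x - h x = 0 := by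
    refine hΩ.ae_eq_zero_of_integral_contDiff_smul_eq_zero
      (f := fun x => g x - h x) (hg.locInt_deriv.sub hh.locInt_deriv) ?_
    intro η h1 h2 h3
    have int : ∀ k : E n → ℝ, LocallyIntegrableOn k Ω →
        IntegrableOn (fun x => k x * η x) Ω := by
      intro k hk
      have hK : IntegrableOn k (tsupport η) := hk.integrableOn_compact_subset h3 h2
      have h4 : IntegrableOn (fun x => k x * η x) (tsupport η) :=
        hK.mul_continuousOn h1.continuous.continuousOn h2
      have h5 : Integrable (fun x => k x * η x) volume := by
        refine (integrableOn_iff_integrable_of_support_subset ?_).mp h4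
        intro x hx
        exact subset_tsupport _ (right_ne_zero_of_mul hx)
      exact h5.integrableOn
    have e := (hg.integral_eq η h1 h2 h3).symm.trans (hh.integral_eq η h1 h2 h3)
    have e2 : ∫ x, η x • (g x - h x) = ∫ x in Ω, (g x * η x - h x * η x) := by
      rw [setIntegral_eq_integral_of_forall_compl_eq_zero]
      · congr 1; funext x; simp only [smul_eq_mul]; ring
      · intro x hx
        have : η x = 0 := image_eq_zero_of_notMem_tsupport (fun h => hx (h3 h))
        simp [this]
    rw [e2, integral_sub (int _ hg.locInt_deriv) (int _ hh.locInt_deriv)]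
    linarith
  rw [ae_restrict_iff' hΩ.measurableSet]
  filter_upwards [key] with x hx hxΩ
  exact sub_eq_zero.mp (hx hxΩ)

/-- The generalized partial derivative is unique up to null sets. -/
lemma IsGenPartial.ae_eq {Ω : Set (E n)} (hΩ : IsOpen Ω) {u : E n → ℝ} {i : Fin n}
    {g h : E n → ℝ} (hg : IsGenPartial Ω u i g) (hh : IsGenPartial Ω u i h) :
    ∀ᵐ x ∂volume.restrict Ω, g x = h x := by
  have key : ∀ q : ℚ, ∀ᵐ x ∂volume.restrict Ω, (q : ℝ) ≠ 0 → |u x - q| ≤ |(q : ℝ)| / 4 →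
      g x = h x := by
    intro q
    by_cases hq : (q : ℝ) = 0
    · exact Filter.Eventually.of_forall fun x h => absurd hq h
    · obtain ⟨G, h1, h2, h3, h4⟩ := exists_truncation hq
      filter_upwards [(hg.truncation G h1 h2 h3).ae_eq hΩ (hh.truncation G h1 h2 h3)]
        with x hx _ hu
      simpa [h4 _ hu] using hx
  filter_upwards [ae_all_iff.mpr key, hg.eq_zero, hh.eq_zero] with x hx h1 h2
  by_cases hu : u x = 0
  · rw [h1 hu, h2 hu]
  · have hu' : 0 < |u x| := abs_pos.mpr hu
    obtain ⟨q, hq1, hq2⟩ := exists_rat_btwn (show u x - |u x| / 8 < u x + |u x| / 8 by linarith)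
    have hd : |u x - q| ≤ |u x| / 8 := abs_le.mpr ⟨by linarith, by linarith⟩
    have ht : |u x| - |(q : ℝ)| ≤ |u x - q| := abs_sub_abs_le_abs_sub _ _
    have hq : 0 < |(q : ℝ)| := by linarith
    exact hx q (abs_pos.mp hq) (by linarith)

open Classical in
/-- The generalized partial derivative `D_i u` (a version of it; `0` if there is none). -/
def genPartial (Ω : Set (E n)) (u : E n → ℝ) (i : Fin n) : E n → ℝ :=
  if h : ∃ g, IsGenPartial Ω u i g then h.choose else 0

/-- The class `S_{1,γ(x),β(x)}(Ω)` (for `u ∈ L¹(Ω)`): the generalized derivatives `D_i u` exist and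
`∫_Ω |u|^{γ+β} dx + ∑_i ∫_Ω |u|^γ |D_i u|^β dx < ∞`. -/
def MemS (Ω : Set (E n)) (γ β u : E n → ℝ) : Prop :=
  IntegrableOn u Ω ∧ (∀ i, ∃ g, IsGenPartial Ω u i g) ∧
  (∫⁻ x in Ω, ENNReal.ofReal (|u x| ^ (γ x + β x))) +
    ∑ i, ∫⁻ x in Ω, ENNReal.ofReal (|u x| ^ γ x * |genPartial Ω u i x| ^ β x) < ⊤

/-- The space `S_{1,γ(x),β(x),θ(x)}(Ω) = S_{1,γ(x),β(x)}(Ω) ∩ L^{θ(x)}(Ω)`; functions that agree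
almost everywhere in `Ω` are identified. -/
def SSpace (Ω : Set (E n)) (γ β θ : E n → ℝ) : Type :=
  {u : Lp ℝ 1 (volume.restrict Ω) // MemS Ω γ β u ∧ MemLebesgue Ω θ u}

/-- A representative of an element of the space. -/
def SSpace.toFun {Ω : Set (E n)} {γ β θ : E n → ℝ} (u : SSpace Ω γ β θ) : E n → ℝ :=
  (u.1 : E n → ℝ)

/-- `φ(x, t) = |t|^{γ(x)/β(x)} t`. -/
def phi (γ β : E n → ℝ) (x : E n) (t : ℝ) : ℝ := |t| ^ (γ x / β x) * t

/-- `φ'_t(x, t) = (γ(x)/β(x) + 1) |t|^{γ(x)/β(x)}`. -/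
def phiT (γ β : E n → ℝ) (x : E n) (t : ℝ) : ℝ := (γ x / β x + 1) * |t| ^ (γ x / β x)

/-- `ψ = θ β / (γ + β)`. -/
def psi (γ β θ : E n → ℝ) (x : E n) : ℝ := θ x * β x / (γ x + β x)

/-- `d(u, v) = ‖φ(u) - φ(v)‖_{L^ψ} + ∑_i ‖φ'_t(u) D_i u - φ'_t(v) D_i v‖_{L^β}`, a priori in
`[0, ∞]`. -/
def dS {Ω : Set (E n)} {γ β θ : E n → ℝ} (u v : SSpace Ω γ β θ) : ℝ≥0∞ :=
  luxNorm Ω (psi γ β θ) (fun x => phi γ β x (u.toFun x) - phi γ β x (v.toFun x)) +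
    ∑ i, luxNorm Ω β (fun x => phiT γ β x (u.toFun x) * genPartial Ω u.toFun i x -
      phiT γ β x (v.toFun x) * genPartial Ω v.toFun i x)

end VarExp

end

/-! The map sending u to (φ(u), φ'_t(u) D_1u, ..., φ'_t(u) D_nu) embeds the space isometrically into
L^ψ × (L^β)^n with the sum of the norms. Hence the metric axioms come from the Luxemburg norms and
the injectivity of φ(x, ·), and, those Lebesgue spaces being complete
(`IsExponent.exists_tendsto_luxNorm`), completeness means that the image is closed. Let (v, w) be
the limit of the images of u_m. The only candidate is u = φ⁻¹(v), to which a subsequence converges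
a.e., and it remains to identify w_i with φ'_t(u) D_iu.

Away from the zeros of u this is soft. If G is a truncation, then G'/φ'_t is bounded and continuous
in t, because G' vanishes near 0. So G'(u_m) D_iu_m, which is G'/φ'_t at u_m times an L¹-convergent
sequence, passes to the limit against test functions (`isGenPartial_of_tendsto`), and D_iu = w_i /
φ'_t(u).

On {u = 0} this says nothing, and w_i = 0 must be proved there (`ae_eq_zero_of_tendsto`). Put r =
γ/β and let χ be a cutoff supported in [-ε, ε]. Integrating by parts with the primitive ∫₀^{u(x)}
(r(x) + 1) |t|^{r(x)} χ(t) dt moves the derivative onto the test function and onto r, which is where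
γ, β ∈ C¹ enters. What is left is an integral over |t| ≤ ε of quantities bounded by means of |t|^r
|log |t|| ≤ 1/r, hence O(ε) uniformly in u (`exists_integral_rpow_le`). The required chain rule with
an x-dependent exponent (`IsGenPartial.integral_rpow_eq`) follows from the truncation property by
expanding |t|^{r(x)} in powers of r(x) log |t|, which separates x from t. -/

namespace VarExp

variable {n : ℕ} {Ω : Set (E n)}

/-! ### Luxemburg norms and completeness of L^{p(x)}. -/

section Luxemburg

variable {p f g : E n → ℝ}

lemma modular_congr (h : ∀ᵐ x ∂volume.restrict Ω, f x = g x) :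
    modular Ω p f = modular Ω p g :=
  lintegral_congr_ae (h.mono fun x hx => by simp only [hx])

lemma luxNorm_congr (h : ∀ᵐ x ∂volume.restrict Ω, f x = g x) :
    luxNorm Ω p f = luxNorm Ω p g := by
  have : ∀ l : ℝ, modular Ω p (fun x => f x / l) = modular Ω p (fun x => g x / l) := fun l =>
    modular_congr (h.mono fun x hx => by simp only [hx])
  simp only [luxNorm, this]

lemma IsExponent.modular_mono (hp : IsExponent Ω p)
    (h : ∀ᵐ x ∂volume.restrict Ω, |f x| ≤ |g x|) : modular Ω p f ≤ modular Ω p g := by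
  refine lintegral_mono_ae ?_
  filter_upwards [h, hp.one_le] with x hx h1
  exact ENNReal.ofReal_le_ofReal (Real.rpow_le_rpow (abs_nonneg _) hx (by linarith))

lemma luxNorm_le {l : ℝ} (hl : 0 < l) (h : modular Ω p (fun x => f x / l) ≤ 1) :
    luxNorm Ω p f ≤ ENNReal.ofReal l :=
  iInf_le_of_le l (iInf_le_of_le hl (iInf_le_of_le h le_rfl))

/-- The infimum need not be known to be attained: strict inequality supplies an admissible k < l,
and σ_p(f / l) decreases in l. -/
lemma IsExponent.modular_div_le_one (hp : IsExponent Ω p) {l : ℝ}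
    (h : luxNorm Ω p f < ENNReal.ofReal l) : modular Ω p (fun x => f x / l) ≤ 1 := by
  simp only [luxNorm, iInf_lt_iff] at h
  obtain ⟨k, hk, h1, h2⟩ := h
  refine le_trans (hp.modular_mono (Filter.Eventually.of_forall fun x => ?_)) h1
  have h3 : k < l := (ENNReal.ofReal_lt_ofReal_iff_of_nonneg hk.le).mp h2
  rw [abs_div, abs_div, abs_of_pos hk, abs_of_pos (hk.trans h3)]
  exact div_le_div_of_nonneg_left (abs_nonneg _) hk h3.le

lemma luxNorm_sub_comm : luxNorm Ω p (fun x => f x - g x) = luxNorm Ω p (fun x => g x - f x) := by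
  have : ∀ l : ℝ, modular Ω p (fun x => (f x - g x) / l) =
      modular Ω p (fun x => (g x - f x) / l) := by
    intro l
    simp only [modular, abs_div, abs_sub_comm]
  simp only [luxNorm, this]

lemma IsExponent.aemeasurable_integrand (hp : IsExponent Ω p)
    (hf : AEMeasurable f (volume.restrict Ω)) :
    AEMeasurable (fun x => ENNReal.ofReal (|f x| ^ p x)) (volume.restrict Ω) :=
  ((measurable_norm.comp_aemeasurable hf).pow hp.aemeasurable).ennreal_ofReal

lemma IsExponent.luxNorm_lt_top (hp : IsExponent Ω p) (h : modular Ω p f < ⊤) :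
    luxNorm Ω p f < ⊤ := by
  -- For l ≥ 1 and p ≥ 1 one has l^{-p} ≤ l^{-1}, so σ_p(f / l) ≤ σ_p(f) / l, and l is taken to be
  -- at least σ_p(f).
  set l : ℝ := max 1 (modular Ω p f).toReal
  have hl : 1 ≤ l := le_max_left _ _
  have hl0 : 0 < l := by linarith
  refine lt_of_le_of_lt (luxNorm_le hl0 ?_) ENNReal.ofReal_lt_top
  have h1 : modular Ω p (fun x => f x / l) ≤ ENNReal.ofReal l⁻¹ * modular Ω p f := by
    rw [modular, modular, ← lintegral_const_mul' _ _ ENNReal.ofReal_ne_top]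
    refine lintegral_mono_ae ?_
    filter_upwards [hp.one_le] with x hx
    rw [← ENNReal.ofReal_mul (by positivity)]
    refine ENNReal.ofReal_le_ofReal ?_
    rw [abs_div, abs_of_pos hl0, div_eq_mul_inv, Real.mul_rpow (abs_nonneg _) (by positivity),
      mul_comm]
    refine mul_le_mul_of_nonneg_right ?_ (by positivity)
    calc l⁻¹ ^ p x ≤ l⁻¹ ^ (1 : ℝ) :=
          Real.rpow_le_rpow_of_exponent_ge (by positivity) (inv_le_one_of_one_le₀ hl) hx
      _ = l⁻¹ := Real.rpow_one _
  refine h1.trans ?_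
  rw [← ENNReal.ofReal_toReal h.ne, ← ENNReal.ofReal_mul (by positivity)]
  refine ENNReal.ofReal_le_one.mpr ?_
  rw [inv_mul_le_iff₀ hl0, mul_one]
  exact le_max_right _ _

/-- Boundedness of the exponent makes finiteness of the modular invariant under scaling; raising |c|
to at least 1 allows p(x) to be replaced by its upper bound. -/
lemma IsExponent.modular_const_mul_lt_top (hp : IsExponent Ω p) (h : modular Ω p f < ⊤)
    (c : ℝ) : modular Ω p (fun x => c * f x) < ⊤ := by
  obtain ⟨C, hC⟩ := hp.bounded
  set d : ℝ := max 1 |c|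
  have hd : 1 ≤ d := le_max_left _ _
  have h1 : modular Ω p (fun x => c * f x) ≤ ENNReal.ofReal (d ^ C) * modular Ω p f := by
    rw [modular, modular, ← lintegral_const_mul' _ _ ENNReal.ofReal_ne_top]
    refine lintegral_mono_ae ?_
    filter_upwards [hp.one_le, hC] with x hx hx2
    rw [← ENNReal.ofReal_mul (by positivity)]
    refine ENNReal.ofReal_le_ofReal ?_
    rw [abs_mul, Real.mul_rpow (abs_nonneg _) (abs_nonneg _)]
    refine mul_le_mul_of_nonneg_right ?_ (by positivity)
    calc |c| ^ p x ≤ d ^ p x :=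
          Real.rpow_le_rpow (abs_nonneg _) (le_max_right _ _) (by linarith)
      _ ≤ d ^ C := Real.rpow_le_rpow_of_exponent_le hd hx2
  exact h1.trans_lt (ENNReal.mul_lt_top ENNReal.ofReal_lt_top h)

lemma IsExponent.modular_lt_top (hp : IsExponent Ω p) (h : luxNorm Ω p f < ⊤) :
    modular Ω p f < ⊤ := by
  set l : ℝ := (luxNorm Ω p f).toReal + 1
  have hl0 : 0 < l := by positivity
  have h1 : luxNorm Ω p f < ENNReal.ofReal l := by
    rw [← ENNReal.ofReal_toReal h.ne]
    exact (ENNReal.ofReal_lt_ofReal_iff hl0).mpr (by simp [l])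
  have h2 := hp.modular_const_mul_lt_top ((hp.modular_div_le_one h1).trans_lt ENNReal.one_lt_top) l
  rwa [show (fun x => l * (f x / l)) = f from funext fun x => by field_simp] at h2

lemma IsExponent.luxNorm_add_le (hp : IsExponent Ω p)
    (hf : AEMeasurable f (volume.restrict Ω)) :
    luxNorm Ω p (fun x => f x + g x) ≤ luxNorm Ω p f + luxNorm Ω p g := by
  conv_rhs => simp only [luxNorm, ENNReal.iInf_add, ENNReal.add_iInf]
  refine le_iInf fun k => le_iInf fun hk => le_iInf fun h2 => le_iInf fun l => le_iInf fun hl =>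
    le_iInf fun h1 => ?_
  rw [← ENNReal.ofReal_add hl.le hk.le]
  refine luxNorm_le (by positivity) ?_
  have hlk : 0 < l + k := by positivity
  calc modular Ω p (fun x => (f x + g x) / (l + k))
      ≤ ∫⁻ x in Ω, (ENNReal.ofReal (l / (l + k)) * ENNReal.ofReal (|f x / l| ^ p x) +
          ENNReal.ofReal (k / (l + k)) * ENNReal.ofReal (|g x / k| ^ p x)) := by
        refine lintegral_mono_ae ?_
        filter_upwards [hp.one_le] with x hx
        rw [← ENNReal.ofReal_mul (by positivity), ← ENNReal.ofReal_mul (by positivity),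
          ← ENNReal.ofReal_add (by positivity) (by positivity)]
        refine ENNReal.ofReal_le_ofReal ?_
        -- Convexity of t ↦ t^p with weights l/(l+k) and k/(l+k), the proportions in which
        -- (f+g)/(l+k) mixes f/l and g/k.
        have := (convexOn_rpow hx).2 (mem_Ici.mpr (abs_nonneg (f x / l)))
          (mem_Ici.mpr (abs_nonneg (g x / k))) (show 0 ≤ l / (l + k) by positivity)
          (show 0 ≤ k / (l + k) by positivity) (by field_simp)
        simp only [smul_eq_mul] at this
        refine le_trans (Real.rpow_le_rpow (abs_nonneg _) ?_ (by linarith)) this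
        have e : (f x + g x) / (l + k) = l / (l + k) * (f x / l) + k / (l + k) * (g x / k) := by
          field_simp
        rw [e]
        refine (abs_add_le _ _).trans (le_of_eq ?_)
        rw [abs_mul, abs_mul, abs_of_pos (show 0 < l / (l + k) by positivity),
          abs_of_pos (show 0 < k / (l + k) by positivity)]
    _ = ENNReal.ofReal (l / (l + k)) * modular Ω p (fun x => f x / l) +
          ENNReal.ofReal (k / (l + k)) * modular Ω p (fun x => g x / k) := by
        rw [lintegral_add_left' ((hp.aemeasurable_integrand (hf.div_const l)).const_mul _),
          lintegral_const_mul' _ _ ENNReal.ofReal_ne_top,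
          lintegral_const_mul' _ _ ENNReal.ofReal_ne_top, modular, modular]
    _ ≤ ENNReal.ofReal (l / (l + k)) * 1 + ENNReal.ofReal (k / (l + k)) * 1 := by gcongr
    _ = 1 := by
        rw [mul_one, mul_one, ← ENNReal.ofReal_add (by positivity) (by positivity), ← add_div,
          div_self hlk.ne', ENNReal.ofReal_one]

lemma IsExponent.luxNorm_sub_le (hp : IsExponent Ω p) {h : E n → ℝ}
    (hf : AEMeasurable f (volume.restrict Ω)) (hg : AEMeasurable g (volume.restrict Ω)) :
    luxNorm Ω p (fun x => f x - h x) ≤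
      luxNorm Ω p (fun x => f x - g x) + luxNorm Ω p (fun x => g x - h x) := by
  have := hp.luxNorm_add_le (f := fun x => f x - g x) (g := fun x => g x - h x) (hf.sub hg)
  simpa using this

lemma IsExponent.luxNorm_sub_lt_top (hp : IsExponent Ω p)
    (hf : AEMeasurable f (volume.restrict Ω)) (h1 : modular Ω p f < ⊤) (h2 : modular Ω p g < ⊤) :
    luxNorm Ω p (fun x => f x - g x) < ⊤ := by
  have h3 := hp.modular_const_mul_lt_top h2 (-1)
  have := hp.luxNorm_add_le (g := fun x => -1 * g x) hf
  simp only [neg_mul, one_mul, ← sub_eq_add_neg] at this h3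
  exact this.trans_lt (ENNReal.add_lt_top.mpr ⟨hp.luxNorm_lt_top h1, hp.luxNorm_lt_top h3⟩)

/-- The Luxemburg norm controls the `L¹` norm on sets of finite measure. -/
lemma IsExponent.lintegral_enorm_le (hp : IsExponent Ω p) (hΩ : volume Ω ≠ ⊤) :
    ∫⁻ x in Ω, ‖f x‖ₑ ≤ (volume Ω + 1) * luxNorm Ω p f := by
  -- Dividing by the constant leaves a bare infimum on the right, so that each admissible l can be
  -- treated separately.
  rw [← ENNReal.div_le_iff' (by simp) (by simp [hΩ])]
  refine le_iInf fun l => le_iInf fun hl => le_iInf fun h1 => ?_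
  rw [ENNReal.div_le_iff' (by simp) (by simp [hΩ])]
  calc ∫⁻ x in Ω, ‖f x‖ₑ
      ≤ ∫⁻ x in Ω, ENNReal.ofReal l * (1 + ENNReal.ofReal (|f x / l| ^ p x)) := by
        refine lintegral_mono_ae ?_
        filter_upwards [hp.one_le] with x hx
        rw [← ENNReal.ofReal_one, ← ENNReal.ofReal_add zero_le_one (by positivity),
          ← ENNReal.ofReal_mul hl.le, Real.enorm_eq_ofReal_abs]
        refine ENNReal.ofReal_le_ofReal ?_
        have h2 : |f x / l| ≤ 1 + |f x / l| ^ p x := by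
          rcases le_total |f x / l| 1 with h | h
          · have : 0 ≤ |f x / l| ^ p x := by positivity
            linarith
          · have := Real.rpow_le_rpow_of_exponent_le h hx
            rw [Real.rpow_one] at this
            linarith
        calc |f x| = l * |f x / l| := by
              rw [abs_div, abs_of_pos hl]; field_simp
          _ ≤ _ := mul_le_mul_of_nonneg_left h2 hl.le
    _ = ENNReal.ofReal l * (volume Ω + modular Ω p (fun x => f x / l)) := by
        rw [lintegral_const_mul' _ _ ENNReal.ofReal_ne_top,
          lintegral_add_left measurable_const, modular]
        simp
    _ ≤ ENNReal.ofReal l * (volume Ω + 1) := by gcongr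
    _ = _ := mul_comm _ _

lemma IsExponent.memLp_one (hp : IsExponent Ω p) (hΩ : volume Ω ≠ ⊤)
    (hf : AEMeasurable f (volume.restrict Ω)) (h : modular Ω p f < ⊤) :
    MemLp f 1 (volume.restrict Ω) := by
  refine ⟨hf.aestronglyMeasurable, ?_⟩
  rw [eLpNorm_one_eq_lintegral_enorm]
  refine (hp.lintegral_enorm_le hΩ).trans_lt (ENNReal.mul_lt_top ?_ (hp.luxNorm_lt_top h))
  simp [lt_top_iff_ne_top, hΩ]

lemma IsExponent.ae_eq_zero (hp : IsExponent Ω p) (hΩ : volume Ω ≠ ⊤)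
    (hf : AEMeasurable f (volume.restrict Ω)) (h : luxNorm Ω p f = 0) :
    ∀ᵐ x ∂volume.restrict Ω, f x = 0 := by
  have h1 := hp.lintegral_enorm_le hΩ (f := f)
  rw [h, mul_zero, nonpos_iff_eq_zero, lintegral_eq_zero_iff' hf.enorm] at h1
  exact h1.mono fun x hx => by simpa using hx

lemma IsExponent.tendsto_eLpNorm (hp : IsExponent Ω p) (hΩ : volume Ω ≠ ⊤) {ι : Type*}
    {F : Filter ι} {f : ι → E n → ℝ}
    (h : Filter.Tendsto (fun m => luxNorm Ω p (fun x => f m x - g x)) F (nhds 0)) :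
    Filter.Tendsto (fun m => eLpNorm (f m - g) 1 (volume.restrict Ω)) F (nhds 0) := by
  have h1 := ENNReal.Tendsto.const_mul (a := volume Ω + 1) h (Or.inr (by simp [hΩ]))
  rw [mul_zero] at h1
  refine tendsto_of_tendsto_of_tendsto_of_le_of_le tendsto_const_nhds h1
    (fun _ => zero_le) fun m => ?_
  rw [eLpNorm_one_eq_lintegral_enorm]
  exact hp.lintegral_enorm_le hΩ

/-- `L^{p(x)}` is complete. -/
lemma IsExponent.exists_tendsto_luxNorm (hp : IsExponent Ω p) (hΩ : volume Ω ≠ ⊤)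
    {f : ℕ → E n → ℝ} (hf : ∀ m, AEMeasurable (f m) (volume.restrict Ω))
    (hmod : ∀ m, modular Ω p (f m) < ⊤)
    (hc : ∀ ε : ℝ≥0∞, 0 < ε → ∃ N, ∀ m ≥ N, ∀ k ≥ N,
      luxNorm Ω p (fun x => f m x - f k x) < ε) :
    ∃ g : E n → ℝ, AEMeasurable g (volume.restrict Ω) ∧ modular Ω p g < ⊤ ∧
      Filter.Tendsto (fun m => luxNorm Ω p (fun x => f m x - g x)) Filter.atTop (nhds 0) := by
  have hmem : ∀ m, MemLp (f m) 1 (volume.restrict Ω) := fun m => hp.memLp_one hΩ (hf m) (hmod m)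
  -- Luxemburg-Cauchy implies L¹-Cauchy, which supplies the candidate limit and an a.e. convergent
  -- subsequence.
  have hcau : CauchySeq fun m => (hmem m).toLp (f m) := by
    rw [EMetric.cauchySeq_iff]
    intro ε hε
    have hA : volume Ω + 1 ≠ ⊤ := by simp [hΩ]
    obtain ⟨N, hN⟩ := hc (ε / (volume Ω + 1)) (ENNReal.div_pos hε.ne' hA)
    refine ⟨N, fun m hm k hk => ?_⟩
    rw [Lp.edist_toLp_toLp, eLpNorm_one_eq_lintegral_enorm]
    refine (hp.lintegral_enorm_le hΩ).trans_lt ?_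
    have := hN m hm k hk
    rw [ENNReal.lt_div_iff_mul_lt (by simp) (by simp [hΩ]), mul_comm] at this
    exact this
  obtain ⟨G, hG⟩ := cauchySeq_tendsto_of_complete hcau
  have hlim : Filter.Tendsto (fun m => eLpNorm (f m - ⇑G) 1 (volume.restrict Ω)) Filter.atTop
      (nhds 0) := by
    have := (Lp.tendsto_Lp_iff_tendsto_eLpNorm' _ _).mp hG
    refine this.congr fun m => eLpNorm_congr_ae ?_
    filter_upwards [(hmem m).coeFn_toLp] with x hx
    simp [hx]
  obtain ⟨ns, hns, hae⟩ := (tendstoInMeasure_of_tendsto_eLpNorm one_ne_zero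
    (fun m => (hf m).aestronglyMeasurable) (Lp.aestronglyMeasurable G) hlim).exists_seq_tendsto_ae
  have hGm : AEMeasurable G (volume.restrict Ω) := (Lp.aestronglyMeasurable G).aemeasurable
  -- Fatou's lemma along the subsequence upgrades the Cauchy estimate to convergence of the whole
  -- sequence in the Luxemburg norm.
  have key : ∀ l : ℝ, 0 < l → ∃ N, ∀ m ≥ N,
      luxNorm Ω p (fun x => f m x - G x) ≤ ENNReal.ofReal l := by
    intro l hl
    obtain ⟨N, hN⟩ := hc (ENNReal.ofReal l) (by simpa using hl)
    refine ⟨N, fun m hm => luxNorm_le hl ?_⟩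
    calc modular Ω p (fun x => (f m x - G x) / l)
        = ∫⁻ x in Ω, Filter.liminf (fun j => ENNReal.ofReal
            (|(f m x - f (ns j) x) / l| ^ p x)) Filter.atTop := by
          refine lintegral_congr_ae ?_
          filter_upwards [hae, hp.one_le] with x hx h1
          refine (Filter.Tendsto.liminf_eq ?_).symm
          refine ENNReal.tendsto_ofReal ?_
          exact (((tendsto_const_nhds.sub hx).div_const l).abs).rpow_const (Or.inr (by linarith))
      _ ≤ Filter.liminf (fun j => modular Ω p (fun x => (f m x - f (ns j) x) / l))
            Filter.atTop :=
          lintegral_liminf_le' fun j =>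
            hp.aemeasurable_integrand (((hf m).sub (hf (ns j))).div_const l)
      _ ≤ 1 := by
          refine Filter.liminf_le_of_frequently_le' (Filter.Eventually.frequently ?_)
          filter_upwards [hns.tendsto_atTop.eventually_ge_atTop N] with j hj
          exact hp.modular_div_le_one (hN m hm _ hj)
  refine ⟨G, hGm, ?_, ?_⟩
  · obtain ⟨N, hN⟩ := key 1 one_pos
    have h1 : luxNorm Ω p (fun x => f N x - G x) < ⊤ :=
      (hN N le_rfl).trans_lt ENNReal.ofReal_lt_top
    rw [luxNorm_sub_comm] at h1
    have h2 := hp.luxNorm_add_le (f := fun x => G x - f N x) (g := f N) (hGm.sub (hf N))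
    simp only [sub_add_cancel] at h2
    exact hp.modular_lt_top
      (h2.trans_lt (ENNReal.add_lt_top.mpr ⟨h1, hp.luxNorm_lt_top (hmod N)⟩))
  · rw [ENNReal.tendsto_atTop_zero]
    intro ε hε
    obtain ⟨l, hl0, hl⟩ := ENNReal.lt_iff_exists_real_btwn.mp hε
    have hl1 : 0 < l := by simpa using hl.1
    obtain ⟨N, hN⟩ := key l hl1
    exact ⟨N, fun m hm => (hN m hm).trans hl.2.le⟩


end Luxemburg

/-! ### Weak derivatives tested against C¹ functions. -/

open scoped Convolution in
/-- `C¹` functions with compact support in an open set are limits, in `C¹`, of smooth functions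
supported in a fixed compact subset. -/
lemma exists_smooth_approx (hΩ : IsOpen Ω) {η : E n → ℝ} (h1 : ContDiff ℝ 1 η)
    (h2 : HasCompactSupport η) (h3 : tsupport η ⊆ Ω) :
    ∃ K ⊆ Ω, IsCompact K ∧ tsupport η ⊆ K ∧ ∀ ε : ℝ, 0 < ε → ∃ ζ : E n → ℝ, ContDiff ℝ ∞ ζ ∧
      tsupport ζ ⊆ K ∧ ∀ x, |ζ x - η x| ≤ ε ∧ ‖fderiv ℝ ζ x - fderiv ℝ η x‖ ≤ ε := by
  obtain ⟨δ, hδ, hK⟩ := h2.isCompact.exists_cthickening_subset_open hΩ h3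
  refine ⟨_, hK, h2.isCompact.cthickening, Metric.self_subset_cthickening _, fun ε hε => ?_⟩
  obtain ⟨δ1, hδ1, hd1⟩ := Metric.uniformContinuous_iff.mp
    (h2.uniformContinuous_of_continuous h1.continuous) ε hε
  obtain ⟨δ2, hδ2, hd2⟩ := Metric.uniformContinuous_iff.mp
    ((h2.fderiv (𝕜 := ℝ)).uniformContinuous_of_continuous (h1.continuous_fderiv one_ne_zero)) ε hε
  -- At this scale mollification stays inside the closed δ-thickening of the support, and both η and
  -- its derivative oscillate by less than ε.
  set ρ := min δ (min δ1 δ2)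
  have hρ : 0 < ρ := by positivity
  let φ : ContDiffBump (0 : E n) := ⟨ρ / 2, ρ, half_pos hρ, half_lt_self hρ⟩
  refine ⟨φ.normed volume ⋆[ContinuousLinearMap.lsmul ℝ ℝ, volume] η, ?_, ?_, fun x => ⟨?_, ?_⟩⟩
  · exact φ.hasCompactSupport_normed.contDiff_convolution_left _ φ.contDiff_normed
      h1.continuous.locallyIntegrable
  · refine closure_minimal ?_ Metric.isClosed_cthickening
    refine (support_convolution_subset _).trans ?_
    rw [φ.support_normed_eq]
    rintro _ ⟨y, hy, z, hz, rfl⟩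
    refine Metric.mem_cthickening_of_dist_le _ z _ _ (subset_tsupport _ hz) ?_
    have : dist y 0 < ρ := hy
    rw [dist_zero_right] at this
    simp only [dist_eq_norm, add_sub_cancel_right]
    exact this.le.trans (min_le_left _ _)
  · rw [← Real.dist_eq]
    refine φ.dist_normed_convolution_le h1.continuous.aestronglyMeasurable fun y hy => ?_
    exact (hd1 (lt_of_lt_of_le hy ((min_le_right _ _).trans (min_le_left _ _)))).le
  · rw [← dist_eq_norm]
    have e := h2.hasFDerivAt_convolution_right (μ := volume) (ContinuousLinearMap.lsmul ℝ ℝ)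
      (φ.continuous_normed (μ := volume)).locallyIntegrable h1 x
    rw [e.fderiv]
    refine φ.dist_normed_convolution_le
      (h1.continuous_fderiv one_ne_zero).aestronglyMeasurable fun y hy => ?_
    exact (hd2 (lt_of_lt_of_le hy ((min_le_right _ _).trans (min_le_right _ _)))).le

lemma setIntegral_eq_of_tsupport_subset {K : Set (E n)} (hK : K ⊆ Ω) 
    {F η : E n → ℝ} (h : tsupport η ⊆ K) (hF : ∀ x, x ∉ tsupport η → F x = 0) :
    ∫ x in Ω, F x = ∫ x in K, F x := by
  rw [setIntegral_eq_integral_of_forall_compl_eq_zero fun x hx => hF x fun h' => hx (hK (h h')),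
    setIntegral_eq_integral_of_forall_compl_eq_zero fun x hx => hF x fun h' => hx (h h')]

lemma fderiv_eq_zero_of_notMem {η : E n → ℝ} {x : E n} (hx : x ∉ tsupport η) :
    fderiv ℝ η x = 0 :=
  image_eq_zero_of_notMem_tsupport fun h => hx (tsupport_fderiv_subset ℝ h)

/-- The integration by parts formula for weak derivatives holds for `C¹` test functions. -/
lemma IsWeakPartial.integral_eq_of_contDiff_one (hΩ : IsOpen Ω) {f g : E n → ℝ} {i : Fin n}
    (h : IsWeakPartial Ω f i g) {η : E n → ℝ} (h1 : ContDiff ℝ 1 η)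
    (h2 : HasCompactSupport η) (h3 : tsupport η ⊆ Ω) :
    ∫ x in Ω, f x * fderiv ℝ η x (EuclideanSpace.single i 1) = -∫ x in Ω, g x * η x := by
  obtain ⟨K, hKΩ, hK, hηK, happ⟩ := exists_smooth_approx hΩ h1 h2 h3
  have hf : IntegrableOn f K := h.locInt_fun.integrableOn_compact_subset hKΩ hK
  have hg : IntegrableOn g K := h.locInt_deriv.integrableOn_compact_subset hKΩ hK
  set e : E n := EuclideanSpace.single i 1
  have he : ‖e‖ = 1 := by simp [e]
  have int1 : ∀ ζ : E n → ℝ, ContDiff ℝ 1 ζ →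
      IntegrableOn (fun x => f x * fderiv ℝ ζ x e) K := fun ζ hζ =>
    hf.mul_continuousOn ((hζ.continuous_fderiv one_ne_zero).clm_apply
      continuous_const).continuousOn hK
  have int2 : ∀ ζ : E n → ℝ, ContDiff ℝ 1 ζ → IntegrableOn (fun x => g x * ζ x) K :=
    fun ζ hζ => hg.mul_continuousOn hζ.continuous.continuousOn hK
  have red1 : ∀ ζ : E n → ℝ, tsupport ζ ⊆ K → ∫ x in Ω, f x * fderiv ℝ ζ x e =
      ∫ x in K, f x * fderiv ℝ ζ x e := fun ζ hζ =>
    setIntegral_eq_of_tsupport_subset hKΩ hζ fun x hx => by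
      simp [fderiv_eq_zero_of_notMem hx]
  have red2 : ∀ ζ : E n → ℝ, tsupport ζ ⊆ K → ∫ x in Ω, g x * ζ x =
      ∫ x in K, g x * ζ x := fun ζ hζ =>
    setIntegral_eq_of_tsupport_subset hKΩ hζ fun x hx => by
      simp [image_eq_zero_of_notMem_tsupport hx]
  rw [red1 η hηK, red2 η hηK]
  -- The formula is exact for the smooth ζ, so the defect for η is that of η - ζ; as K does not
  -- depend on ε, it is at most ε times a fixed L¹ mass.
  have key : ∀ ε : ℝ, 0 < ε → |(∫ x in K, f x * fderiv ℝ η x e) + ∫ x in K, g x * η x| ≤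
      ε * ∫ x in K, (|f x| + |g x|) := by
    intro ε hε
    obtain ⟨ζ, hζ, hζK, hζη⟩ := happ ε hε
    have hζ1 : ContDiff ℝ 1 ζ := hζ.of_le (by exact_mod_cast le_top)
    have h0 := h.integral_eq ζ hζ
      (HasCompactSupport.intro' hK hK.isClosed fun x hx =>
        image_eq_zero_of_notMem_tsupport fun h => hx (hζK h)) (hζK.trans hKΩ)
    rw [red1 ζ hζK, red2 ζ hζK] at h0
    have e1 : (∫ x in K, f x * fderiv ℝ η x e) + ∫ x in K, g x * η x =
        ∫ x in K, ((f x * fderiv ℝ η x e - f x * fderiv ℝ ζ x e) + (g x * η x - g x * ζ x)) := by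
      have i1 : IntegrableOn (fun x => f x * fderiv ℝ η x e - f x * fderiv ℝ ζ x e) K :=
        (int1 η h1).sub (int1 ζ hζ1)
      have i2 : IntegrableOn (fun x => g x * η x - g x * ζ x) K := (int2 η h1).sub (int2 ζ hζ1)
      rw [integral_add i1 i2,
        integral_sub (int1 η h1) (int1 ζ hζ1), integral_sub (int2 η h1) (int2 ζ hζ1)]
      linarith
    rw [e1, ← integral_const_mul, ← Real.norm_eq_abs]
    refine norm_integral_le_of_norm_le ((hf.abs.add hg.abs).const_mul ε)
      (Filter.Eventually.of_forall fun x => ?_)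
    obtain ⟨b1, b2⟩ := hζη x
    have b3 : |fderiv ℝ ζ x e - fderiv ℝ η x e| ≤ ε := by
      have := (fderiv ℝ ζ x - fderiv ℝ η x).le_opNorm e
      rw [he, mul_one] at this
      exact this.trans b2
    rw [Real.norm_eq_abs, ← mul_sub, ← mul_sub]
    refine (abs_add_le _ _).trans ?_
    rw [abs_mul, abs_mul, mul_add, abs_sub_comm, abs_sub_comm (η x), mul_comm ε, mul_comm ε]
    gcongr
  have hz : |(∫ x in K, f x * fderiv ℝ η x e) + ∫ x in K, g x * η x| ≤ 0 := by
    have hlim : Filter.Tendsto (fun ε : ℝ => ε * ∫ x in K, (|f x| + |g x|))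
        (nhdsWithin 0 (Ioi 0)) (nhds 0) := by
      have : Filter.Tendsto (fun ε : ℝ => ε * ∫ x in K, (|f x| + |g x|)) (nhds 0)
          (nhds (0 * ∫ x in K, (|f x| + |g x|))) := Filter.tendsto_id.mul_const _
      rw [zero_mul] at this
      exact this.mono_left nhdsWithin_le_nhds
    exact ge_of_tendsto hlim (by filter_upwards [self_mem_nhdsWithin] with ε hε using key ε hε)
  have := abs_nonpos_iff.mp hz
  linarith

/-! ### Truncations prescribed by their derivatives. -/

section Primitive

variable {q : ℝ → ℝ}

lemma deriv_primitive (hq : Continuous q) : deriv (fun t => ∫ s in (0 : ℝ)..t, q s) = q := by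
  funext t
  exact hq.deriv_integral _ 0 t

lemma contDiff_one_primitive (hq : Continuous q) :
    ContDiff ℝ 1 (fun t => ∫ s in (0 : ℝ)..t, q s) := by
  rw [contDiff_one_iff_deriv, deriv_primitive hq]
  exact ⟨fun t => (hq.integral_hasStrictDerivAt 0 t).hasDerivAt.differentiableAt, hq⟩

lemma abs_primitive_le (hq : Continuous q) (h : HasCompactSupport q) (t : ℝ) :
    |∫ s in (0 : ℝ)..t, q s| ≤ ∫ s, |q s| := by
  have hi : Integrable q := hq.integrable_of_hasCompactSupport h
  rw [← Real.norm_eq_abs]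
  refine intervalIntegral.norm_integral_le_integral_norm_uIoc.trans ?_
  exact setIntegral_le_integral hi.norm (Filter.Eventually.of_forall fun _ => norm_nonneg _)

lemma exists_bound_of_hasCompactSupport_deriv {G : ℝ → ℝ} (hG : ContDiff ℝ 1 G)
    (h : HasCompactSupport (deriv G)) : ∃ M, ∀ t, |G t| ≤ M := by
  have hc : Continuous (deriv G) := hG.continuous_deriv le_rfl
  refine ⟨|G 0| + ∫ s, |deriv G s|, fun t => ?_⟩
  have h1 := abs_primitive_le hc h t
  rw [intervalIntegral.integral_deriv_eq_sub
    (fun x _ => (hG.differentiable one_ne_zero).differentiableAt)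
    (hc.intervalIntegrable _ _)] at h1
  have := abs_add_le (G 0) (G t - G 0)
  rw [add_sub_cancel] at this
  linarith

end Primitive

/-- Testing the truncation with derivative `q` against a `C¹` function. -/
lemma IsGenPartial.integral_primitive_mul (hΩ : IsOpen Ω) {u g : E n → ℝ} {i : Fin n}
    (hu : IsGenPartial Ω u i g) {q : ℝ → ℝ} (hq : Continuous q) (hq1 : HasCompactSupport q)
    (hq2 : (0 : ℝ) ∉ tsupport q) {η : E n → ℝ} (h1 : ContDiff ℝ 1 η)
    (h2 : HasCompactSupport η) (h3 : tsupport η ⊆ Ω) :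
    ∫ x in Ω, (∫ s in (0 : ℝ)..u x, q s) * fderiv ℝ η x (EuclideanSpace.single i 1) =
      -∫ x in Ω, q (u x) * g x * η x := by
  have := (hu.truncation (fun t => ∫ s in (0 : ℝ)..t, q s) (contDiff_one_primitive hq)
    (by rwa [deriv_primitive hq]) (by rwa [deriv_primitive hq])).integral_eq_of_contDiff_one
    hΩ h1 h2 h3
  simpa only [deriv_primitive hq] using this

lemma IsGenPartial.locallyIntegrableOn {u g : E n → ℝ} {i : Fin n}
    (hu : IsGenPartial Ω u i g) {q : ℝ → ℝ} (hq : Continuous q) (hq1 : HasCompactSupport q)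
    (hq2 : (0 : ℝ) ∉ tsupport q) : LocallyIntegrableOn (fun x => q (u x) * g x) Ω := by
  have := (hu.truncation (fun t => ∫ s in (0 : ℝ)..t, q s) (contDiff_one_primitive hq)
    (by rwa [deriv_primitive hq]) (by rwa [deriv_primitive hq])).locInt_deriv
  simpa only [deriv_primitive hq] using this


/-! ### The chain rule with a variable exponent, through the exponential series. -/

lemma hasSum_pow_div_factorial (z : ℝ) :
    HasSum (fun k : ℕ => z ^ k / k.factorial) (Real.exp z) := by
  rw [Real.exp_eq_exp_ℝ]
  exact NormedSpace.expSeries_div_hasSum_exp z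

lemma hasSum_exp_mul (L r : ℝ) :
    HasSum (fun k : ℕ => L ^ k / k.factorial * r ^ k) (Real.exp (r * L)) := by
  refine (hasSum_pow_div_factorial (r * L)).congr_fun ?_
  intro k
  rw [mul_pow]; ring

lemma hasSum_exp_mul_deriv (L r : ℝ) :
    HasSum (fun k : ℕ => L ^ k / k.factorial * (k * r ^ (k - 1))) (L * Real.exp (r * L)) := by
  -- The factor k kills the term k = 0, so the truncated `k - 1` is harmless and the series can be
  -- shifted by one.
  rw [← hasSum_nat_add_iff' 1]
  simp only [Finset.range_one, Finset.sum_singleton, CharP.cast_eq_zero, zero_mul, mul_zero,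
    sub_zero]
  refine ((hasSum_exp_mul L r).mul_left L).congr_fun ?_
  intro k
  rw [Nat.factorial_succ, add_tsub_cancel_right, pow_succ]
  push_cast
  have : (k.factorial : ℝ) ≠ 0 := by positivity
  field_simp

/-- The product vanishes near 0, so a singularity of h there, such as that of a power of the
logarithm or of 1/φ'_t, disappears. -/
lemma continuous_mul_of_notMem_tsupport {χ h : ℝ → ℝ} (hχ : Continuous χ)
    (h0 : (0 : ℝ) ∉ tsupport χ) (hh : ContinuousOn h {0}ᶜ) : Continuous fun t => h t * χ t := by
  rw [continuous_iff_continuousAt]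
  intro t
  by_cases ht : t ∈ tsupport χ
  · have : t ≠ 0 := fun h => h0 (h ▸ ht)
    exact (hh.continuousAt (isOpen_compl_singleton.mem_nhds this)).mul hχ.continuousAt
  · have : (fun t => h t * χ t) =ᶠ[nhds t] fun _ => 0 := by
      filter_upwards [notMem_tsupport_iff_eventuallyEq.mp ht] with s hs
      simp [hs]
    exact continuousAt_const.congr this.symm

/-- The directional derivative of `(r + 1) r ^ k ζ`, where `D`, `d` are those of `r`, `ζ`. -/
def powCoeff (r D d z : ℝ) (k : ℕ) : ℝ :=
  (r + 1) * r ^ k * d + z * D * (r ^ k + (r + 1) * (k * r ^ (k - 1)))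

/-- Termwise differentiation in x of (r + 1) e^{rL} ζ, with L playing the role of log |t|. -/
lemma hasSum_powCoeff (r D d z L : ℝ) :
    HasSum (fun k : ℕ => L ^ k / k.factorial * powCoeff r D d z k)
      (Real.exp (r * L) * ((r + 1) * d + z * D * (1 + (r + 1) * L))) := by
  have h1 := (hasSum_exp_mul L r).mul_left ((r + 1) * d + z * D)
  have h2 := (hasSum_exp_mul_deriv L r).mul_left (z * D * (r + 1))
  have h3 := h1.add h2
  rw [show Real.exp (r * L) * ((r + 1) * d + z * D * (1 + (r + 1) * L)) =
    ((r + 1) * d + z * D) * Real.exp (r * L) + z * D * (r + 1) * (L * Real.exp (r * L)) by ring]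
  refine h3.congr_fun fun k => ?_
  simp only [powCoeff]; ring

/-- The factor k produced by differentiating r^k is absorbed by k ≤ 2^k; the resulting geometric
growth is summable against M^k / k!. -/
lemma abs_powCoeff_le {r D d z R : ℝ} (hR : 1 ≤ R) (hr : |r| ≤ R) (hD : |D| ≤ R) (hd : |d| ≤ R)
    (hz : |z| ≤ R) (k : ℕ) : |powCoeff r D d z k| ≤ 3 * (R + 1) ^ 3 * (2 * R) ^ k := by
  have hr1 : |r + 1| ≤ R + 1 := (abs_add_le _ _).trans (by simpa using hr)
  have hk : (k : ℝ) ≤ 2 ^ k := by exact_mod_cast Nat.lt_two_pow_self.le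
  have h2 : (1 : ℝ) ≤ 2 ^ k := one_le_pow₀ (by norm_num)
  have hrk : |r ^ k| ≤ R ^ k := by rw [abs_pow]; gcongr
  have hrk1 : |r ^ (k - 1)| ≤ R ^ k := by
    rw [abs_pow]
    calc |r| ^ (k - 1) ≤ R ^ (k - 1) := by gcongr
      _ ≤ R ^ k := pow_le_pow_right₀ hR (Nat.sub_le _ _)
  have hRk : 0 ≤ R ^ k := by positivity
  have a1 : |(r + 1) * r ^ k * d| ≤ (R + 1) * R ^ k * R := by
    rw [abs_mul, abs_mul]; gcongr
  have a2 : |r ^ k + (r + 1) * (k * r ^ (k - 1))| ≤ R ^ k + (R + 1) * (2 ^ k * R ^ k) := by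
    refine (abs_add_le _ _).trans ?_
    rw [abs_mul, abs_mul, Nat.abs_cast]; gcongr
  have a3 : |z * D * (r ^ k + (r + 1) * (k * r ^ (k - 1)))| ≤
      R * R * (R ^ k + (R + 1) * (2 ^ k * R ^ k)) := by
    rw [abs_mul, abs_mul]; gcongr
  have hb : R ^ k ≤ 2 ^ k * R ^ k := le_mul_of_one_le_left hRk h2
  calc |powCoeff r D d z k| ≤ (R + 1) * R ^ k * R + R * R * (R ^ k + (R + 1) * (2 ^ k * R ^ k)) :=
        (abs_add_le _ _).trans (add_le_add a1 a3)
    _ ≤ (R + 1) * (2 ^ k * R ^ k) * R + R * R * (2 ^ k * R ^ k + (R + 1) * (2 ^ k * R ^ k)) := by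
        gcongr
    _ = ((R + 1) * R + R * R * (1 + (R + 1))) * (2 ^ k * R ^ k) := by ring
    _ ≤ 3 * (R + 1) ^ 3 * (2 ^ k * R ^ k) := by
        refine mul_le_mul_of_nonneg_right ?_ (by positivity)
        nlinarith [pow_nonneg (zero_le_one.trans hR) 3, pow_nonneg (zero_le_one.trans hR) 2]
    _ = _ := by rw [mul_pow]

lemma contDiff_mul_of_tsupport_subset (hΩ : IsOpen Ω) {a ζ : E n → ℝ}
    (ha : ContDiffOn ℝ 1 a Ω) (hζ : ContDiff ℝ 1 ζ) (h : tsupport ζ ⊆ Ω) :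
    ContDiff ℝ 1 (fun x => a x * ζ x) := by
  rw [contDiff_iff_contDiffAt]
  intro x
  by_cases hx : x ∈ tsupport ζ
  · exact ((ha x (h hx)).contDiffAt (hΩ.mem_nhds (h hx))).mul hζ.contDiffAt
  · have : (fun x => a x * ζ x) =ᶠ[nhds x] fun _ => 0 := by
      filter_upwards [notMem_tsupport_iff_eventuallyEq.mp hx] with y hy
      simp [hy]
    exact contDiffAt_const.congr_of_eventuallyEq this

lemma fderiv_pow_mul (hΩ : IsOpen Ω) {r ζ : E n → ℝ} (hr : ContDiffOn ℝ 1 r Ω)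
    (hζ : ContDiff ℝ 1 ζ) {x : E n} (hx : x ∈ Ω) (e : E n) (k : ℕ) :
    fderiv ℝ (fun y => (r y + 1) * r y ^ k * ζ y) x e =
      powCoeff (r x) (fderiv ℝ r x e) (fderiv ℝ ζ x e) (ζ x) k := by
  have h1 : HasFDerivAt r (fderiv ℝ r x) x :=
    (((hr x hx).contDiffAt (hΩ.mem_nhds hx)).differentiableAt one_ne_zero).hasFDerivAt
  have h2 : HasFDerivAt ζ (fderiv ℝ ζ x) x :=
    (hζ.differentiable one_ne_zero).differentiableAt.hasFDerivAt
  have h3 := ((h1.add_const 1).mul (h1.pow k)).mul h2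
  have h4 : HasFDerivAt (fun y => (r y + 1) * r y ^ k * ζ y) _ x := h3
  rw [h4.fderiv]
  simp [powCoeff]
  ring

lemma exists_log_bound {χ : ℝ → ℝ} (h1 : HasCompactSupport χ) (h0 : (0 : ℝ) ∉ tsupport χ) :
    ∃ M : ℝ, 0 ≤ M ∧ ∀ t ∈ tsupport χ, |Real.log t| ≤ M := by
  obtain ⟨M, hM⟩ := h1.isCompact.exists_bound_of_continuousOn (f := Real.log)
    (Real.continuousOn_log.mono fun t ht h => h0 (h ▸ ht))
  exact ⟨|M|, abs_nonneg _, fun t ht => (hM t ht).trans (le_abs_self _)⟩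

/-- Chain rule for `x ↦ ∫₀^{u(x)} (r(x) + 1) |τ|^{r(x)} χ(τ) dτ` in integrated form. -/
lemma IsGenPartial.integral_rpow_eq (hΩ : IsOpen Ω) (hfin : volume Ω ≠ ⊤) {u g r ζ : E n → ℝ}
    {i : Fin n} (hum : AEMeasurable u (volume.restrict Ω)) (hu : IsGenPartial Ω u i g)
    {χ : ℝ → ℝ} (hχ : Continuous χ)
    (hχ1 : HasCompactSupport χ) (hχ0 : (0 : ℝ) ∉ tsupport χ) (hr : ContDiffOn ℝ 1 r Ω)
    (hζ : ContDiff ℝ 1 ζ) (hζ1 : HasCompactSupport ζ) (hζΩ : tsupport ζ ⊆ Ω) :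
    ∫ x in Ω, (r x + 1) * Real.exp (r x * Real.log (u x)) * χ (u x) * g x * ζ x =
      -∫ x in Ω, ∫ t in (0 : ℝ)..u x, χ t * (Real.exp (r x * Real.log t) *
        ((r x + 1) * fderiv ℝ ζ x (EuclideanSpace.single i 1) +
          ζ x * fderiv ℝ r x (EuclideanSpace.single i 1) * (1 + (r x + 1) * Real.log t))) := by
  set e : E n := EuclideanSpace.single i 1
  obtain ⟨M, hM0, hM⟩ := exists_log_bound hχ1 hχ0
  have hK : IsCompact (tsupport ζ) := hζ1.isCompact
  obtain ⟨R, hR1, hR⟩ : ∃ R : ℝ, 1 ≤ R ∧ ∀ x ∈ tsupport ζ, |r x| ≤ R ∧ |fderiv ℝ r x e| ≤ R ∧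
      |fderiv ℝ ζ x e| ≤ R ∧ |ζ x| ≤ R := by
    have hf : ContinuousOn (fun x => (r x, fderiv ℝ r x e, fderiv ℝ ζ x e, ζ x)) (tsupport ζ) :=
      ((hr.continuousOn).mono hζΩ).prodMk ((((hr.continuousOn_fderiv_of_isOpen hΩ
        le_rfl).mono hζΩ).clm_apply continuousOn_const).prodMk
        ((((hζ.continuous_fderiv one_ne_zero).clm_apply continuous_const).continuousOn).prodMk
        hζ.continuous.continuousOn))
    obtain ⟨C, hC⟩ := hK.exists_bound_of_continuousOn hf
    refine ⟨max 1 C, le_max_left _ _, fun x hx => ?_⟩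
    have := (hC x hx).trans (le_max_right 1 C)
    simp only [Prod.norm_def, sup_le_iff, Real.norm_eq_abs] at this
    exact this
  have hR0 : 0 ≤ R := zero_le_one.trans hR1
  -- Separation of variables: |t|^r χ(t) is the sum of r^k q_k(t). Each q_k is an admissible
  -- truncation derivative, since χ vanishes near 0.
  set q : ℕ → ℝ → ℝ := fun k t => Real.log t ^ k / k.factorial * χ t with hq
  have hqc : ∀ k, Continuous (q k) := fun k =>
    continuous_mul_of_notMem_tsupport hχ hχ0 ((Real.continuousOn_log.pow k).div_const _)
  have hqs : ∀ k, HasCompactSupport (q k) := fun k => hχ1.mul_left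
  have hq0 : ∀ k, (0 : ℝ) ∉ tsupport (q k) := fun k h => hχ0 (tsupport_mul_subset_right h)
  have hqb : ∀ k t, |q k t| ≤ M ^ k / k.factorial * |χ t| := by
    intro k t
    by_cases ht : t ∈ tsupport χ
    · simp only [hq, abs_mul, abs_div, abs_pow, Nat.abs_cast]
      gcongr
      exact hM t ht
    · simp [hq, image_eq_zero_of_notMem_tsupport ht]
  -- The x-dependent factors go into the test function, which is only C¹ because r is; this is the
  -- use of the extension to C¹ test functions.
  set a : ℕ → E n → ℝ := fun k x => (r x + 1) * r x ^ k * ζ x with ha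
  have hac : ∀ k, ContDiff ℝ 1 (a k) := fun k =>
    contDiff_mul_of_tsupport_subset hΩ ((hr.add contDiffOn_const).mul (hr.pow k)) hζ hζΩ
  have has : ∀ k, tsupport (a k) ⊆ tsupport ζ := fun k => tsupport_mul_subset_right
  have hident : ∀ k, ∫ x in Ω, (∫ s in (0 : ℝ)..u x, q k s) * fderiv ℝ (a k) x e =
      -∫ x in Ω, q k (u x) * g x * a k x := fun k =>
    hu.integral_primitive_mul hΩ (hqc k) (hqs k) (hq0 k) (hac k) hζ1.mul_left ((has k).trans hζΩ)
  set c : E n → ℕ → ℝ := fun x k => powCoeff (r x) (fderiv ℝ r x e) (fderiv ℝ ζ x e) (ζ x) k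
    with hc
  have hcb : ∀ x k, |c x k| ≤ 3 * (R + 1) ^ 3 * (2 * R) ^ k := by
    intro x k
    by_cases hx : x ∈ tsupport ζ
    · obtain ⟨b1, b2, b3, b4⟩ := hR x hx
      exact abs_powCoeff_le hR1 b1 b2 b3 b4 k
    · simp only [hc, powCoeff, image_eq_zero_of_notMem_tsupport hx, fderiv_eq_zero_of_notMem hx]
      simp only [_root_.zero_apply, mul_zero, zero_mul, add_zero, abs_zero]
      positivity
  have hS := hasSum_pow_div_factorial
  -- left hand side
  have sum1 : HasSum (fun k => ∫ x in Ω, q k (u x) * g x * a k x)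
      (∫ x in Ω, (r x + 1) * Real.exp (r x * Real.log (u x)) * χ (u x) * g x * ζ x) := by
    have hloc := hu.locallyIntegrableOn hχ hχ1 hχ0
    have hint : IntegrableOn (fun x => χ (u x) * g x * ζ x) Ω := by
      have h1 : IntegrableOn (fun x => χ (u x) * g x * ζ x) (tsupport ζ) :=
        (hloc.integrableOn_compact_subset hζΩ hK).mul_continuousOn hζ.continuous.continuousOn hK
      refine ((integrableOn_iff_integrable_of_support_subset ?_).mp h1).integrableOn
      intro x hx
      exact subset_tsupport _ (right_ne_zero_of_mul hx)
    refine hasSum_integral_of_dominated_convergence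
      (fun k x => |χ (u x) * g x * ζ x| * (R + 1) * ((M * R) ^ k / k.factorial)) ?_ ?_ ?_ ?_ ?_
    · intro k
      exact (((hqc k).measurable.comp_aemeasurable hum).mul hu.aemeasurable).aestronglyMeasurable.mul
        (hac k).continuous.aestronglyMeasurable
    · intro k
      refine Filter.Eventually.of_forall fun x => ?_
      by_cases hx : x ∈ tsupport ζ
      · obtain ⟨b1, -, -, -⟩ := hR x hx
        have hr1 : |r x + 1| ≤ R + 1 := (abs_add_le _ _).trans (by simpa using b1)
        simp only [ha, Real.norm_eq_abs, abs_mul, abs_pow]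
        calc |q k (u x)| * |g x| * (|r x + 1| * |r x| ^ k * |ζ x|)
            ≤ (M ^ k / k.factorial * |χ (u x)|) * |g x| * ((R + 1) * R ^ k * |ζ x|) := by
              gcongr
              exact hqb k _
          _ = _ := by rw [mul_pow]; ring
      · simp [ha, image_eq_zero_of_notMem_tsupport hx]
    · exact Filter.Eventually.of_forall fun x => (hS _).summable.mul_left _
    · simp only [tsum_mul_left]
      exact (hint.abs.mul_const _).mul_const _
    · refine Filter.Eventually.of_forall fun x => ?_
      have := (hasSum_exp_mul (Real.log (u x)) (r x)).mul_left (χ (u x) * g x * ζ x * (r x + 1))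
      rw [show (r x + 1) * Real.exp (r x * Real.log (u x)) * χ (u x) * g x * ζ x =
        χ (u x) * g x * ζ x * (r x + 1) * Real.exp (r x * Real.log (u x)) by ring]
      refine this.congr_fun fun k => ?_
      simp only [hq, ha]; ring
  -- right hand side
  have sum2 : HasSum (fun k => ∫ x in Ω, (∫ s in (0 : ℝ)..u x, q k s) * fderiv ℝ (a k) x e)
      (∫ x in Ω, ∫ t in (0 : ℝ)..u x, χ t * (Real.exp (r x * Real.log t) *
        ((r x + 1) * fderiv ℝ ζ x e + ζ x * fderiv ℝ r x e * (1 + (r x + 1) * Real.log t)))) := by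
    refine hasSum_integral_of_dominated_convergence
      (fun k x => (∫ s, |χ s|) * (3 * (R + 1) ^ 3) * ((M * (2 * R)) ^ k / k.factorial))
      ?_ ?_ ?_ ?_ ?_
    · intro k
      exact ((contDiff_one_primitive (hqc k)).continuous.measurable.comp_aemeasurable
        hum).aestronglyMeasurable.mul
        (((hac k).continuous_fderiv one_ne_zero).clm_apply continuous_const).aestronglyMeasurable
    · intro k
      rw [ae_restrict_iff' hΩ.measurableSet]
      refine Filter.Eventually.of_forall fun x hx => ?_
      have h1 : fderiv ℝ (a k) x e = c x k := fderiv_pow_mul hΩ hr hζ hx e k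
      rw [h1, norm_mul, Real.norm_eq_abs, Real.norm_eq_abs]
      have h2 : |∫ s in (0 : ℝ)..u x, q k s| ≤ M ^ k / k.factorial * ∫ s, |χ s| := by
        refine (abs_primitive_le (hqc k) (hqs k) _).trans ?_
        rw [← integral_const_mul]
        exact integral_mono ((hqc k).integrable_of_hasCompactSupport (hqs k)).abs
          ((hχ.integrable_of_hasCompactSupport hχ1).abs.const_mul _) (hqb k)
      have h3 : 0 ≤ ∫ s, |χ s| := integral_nonneg fun _ => abs_nonneg _
      calc _ ≤ (M ^ k / k.factorial * ∫ s, |χ s|) * (3 * (R + 1) ^ 3 * (2 * R) ^ k) := by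
            gcongr
            exact hcb x k
        _ = _ := by rw [mul_pow]; ring
    · exact Filter.Eventually.of_forall fun x => (hS _).summable.mul_left _
    · have : IsFiniteMeasure (volume.restrict Ω) := ⟨by simpa [lt_top_iff_ne_top] using hfin⟩
      exact integrable_const _
    · rw [ae_restrict_iff' hΩ.measurableSet]
      refine Filter.Eventually.of_forall fun x hx => ?_
      -- The coefficient does not depend on s and moves inside the inner integral, where a second
      -- dominated convergence sums the series.
      have h1 : ∀ k, (∫ s in (0 : ℝ)..u x, q k s) * fderiv ℝ (a k) x e =
          ∫ s in (0 : ℝ)..u x, q k s * c x k := by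
        intro k
        rw [intervalIntegral.integral_mul_const]
        congr 1
        exact fderiv_pow_mul hΩ hr hζ hx e k
      simp only [h1]
      refine intervalIntegral.hasSum_integral_of_dominated_convergence
        (fun k t => |χ t| * (3 * (R + 1) ^ 3) * ((M * (2 * R)) ^ k / k.factorial))
        ?_ ?_ ?_ ?_ ?_
      · intro k
        exact ((hqc k).mul continuous_const).aestronglyMeasurable
      · intro k
        refine Filter.Eventually.of_forall fun t _ => ?_
        rw [norm_mul, Real.norm_eq_abs, Real.norm_eq_abs]
        calc _ ≤ (M ^ k / k.factorial * |χ t|) * (3 * (R + 1) ^ 3 * (2 * R) ^ k) := by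
              gcongr
              exacts [hqb k t, hcb x k]
          _ = _ := by rw [mul_pow]; ring
      · exact Filter.Eventually.of_forall fun t _ => (hS _).summable.mul_left _
      · simp only [tsum_mul_left]
        exact ((hχ.abs.mul continuous_const).mul continuous_const).intervalIntegrable _ _
      · refine Filter.Eventually.of_forall fun t _ => ?_
        refine ((hasSum_powCoeff (r x) (fderiv ℝ r x e) (fderiv ℝ ζ x e) (ζ x)
          (Real.log t)).mul_left (χ t)).congr_fun fun k => ?_
        simp only [hq, hc]; ring
  simp only [hident] at sum2
  rw [sum2.unique sum1.neg, neg_neg]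

/-- If the cutoff `χ` lives in `{|t| ≤ ε}`, the integral of `(r + 1) |u|^r χ(u) D_i u ζ` is
`O(ε)`, uniformly in `u`. -/
lemma exists_integral_rpow_le (hΩ : IsOpen Ω) (hfin : volume Ω ≠ ⊤) {r ζ : E n → ℝ}
    (hr : ContDiffOn ℝ 1 r Ω) (hr0 : ∀ x ∈ Ω, 0 < r x) (hζ : ContDiff ℝ 1 ζ)
    (hζ1 : HasCompactSupport ζ) (hζΩ : tsupport ζ ⊆ Ω) (i : Fin n) :
    ∃ C : ℝ, 0 ≤ C ∧ ∀ (u g : E n → ℝ), AEMeasurable u (volume.restrict Ω) →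
      IsGenPartial Ω u i g → ∀ (χ : ℝ → ℝ) (ε : ℝ), Continuous χ → HasCompactSupport χ →
      (0 : ℝ) ∉ tsupport χ → (∀ t, |χ t| ≤ 1) → 0 < ε → ε ≤ 1 → (∀ t, ε < |t| → χ t = 0) →
      |∫ x in Ω, (r x + 1) * |u x| ^ r x * χ (u x) * g x * ζ x| ≤ C * ε := by
  set e : E n := EuclideanSpace.single i 1
  have hK : IsCompact (tsupport ζ) := hζ1.isCompact
  obtain ⟨R, hR1, hR⟩ : ∃ R : ℝ, 1 ≤ R ∧ ∀ x ∈ tsupport ζ, |r x| ≤ R ∧ |fderiv ℝ r x e| ≤ R ∧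
      |fderiv ℝ ζ x e| ≤ R ∧ |ζ x| ≤ R ∧ |(r x)⁻¹| ≤ R := by
    have hf : ContinuousOn (fun x => (r x, fderiv ℝ r x e, fderiv ℝ ζ x e, ζ x, (r x)⁻¹))
        (tsupport ζ) :=
      ((hr.continuousOn).mono hζΩ).prodMk ((((hr.continuousOn_fderiv_of_isOpen hΩ
        le_rfl).mono hζΩ).clm_apply continuousOn_const).prodMk
        ((((hζ.continuous_fderiv one_ne_zero).clm_apply continuous_const).continuousOn).prodMk
        (hζ.continuous.continuousOn.prodMk
        (((hr.continuousOn).mono hζΩ).inv₀ fun x hx => (hr0 x (hζΩ hx)).ne'))))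
    obtain ⟨C, hC⟩ := hK.exists_bound_of_continuousOn hf
    refine ⟨max 1 C, le_max_left _ _, fun x hx => ?_⟩
    have := (hC x hx).trans (le_max_right 1 C)
    simp only [Prod.norm_def, sup_le_iff, Real.norm_eq_abs] at this
    exact this
  -- B bounds the inner integrand, its two products coming from the derivatives of ζ and of r;
  -- integrating over [-ε, ε] and then over Ω gives 2 B ε |Ω|.
  set B : ℝ := (R + 1) * R + R * R * (1 + (R + 1) * R)
  have hB : 0 ≤ B := by positivity
  refine ⟨B * 2 * volume.real Ω, by positivity, ?_⟩
  intro u g hum hu χ ε hχ hχ1 hχ0 hχb hε hε1 hχε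
  have h1 := hu.integral_rpow_eq hΩ hfin hum hχ hχ1 hχ0 hr hζ hζ1 hζΩ
  -- `Real.log t` is log |t|, so both forms agree off the zeros of u, and at the zeros the cutoff
  -- kills both.
  have e1 : ∫ x in Ω, (r x + 1) * |u x| ^ r x * χ (u x) * g x * ζ x =
      ∫ x in Ω, (r x + 1) * Real.exp (r x * Real.log (u x)) * χ (u x) * g x * ζ x := by
    congr 1
    funext x
    by_cases hx : u x = 0
    · simp [hx, image_eq_zero_of_notMem_tsupport hχ0]
    · rw [Real.rpow_def_of_pos (abs_pos.mpr hx), Real.log_abs, mul_comm (Real.log _)]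
  rw [e1, h1, abs_neg, ← Real.norm_eq_abs]
  have hbound : ∀ x, ‖∫ t in (0 : ℝ)..u x, χ t * (Real.exp (r x * Real.log t) *
        ((r x + 1) * fderiv ℝ ζ x e + ζ x * fderiv ℝ r x e * (1 + (r x + 1) * Real.log t)))‖
      ≤ B * 2 * ε := by
    intro x
    by_cases hx : x ∈ tsupport ζ
    swap
    · simp only [image_eq_zero_of_notMem_tsupport hx, fderiv_eq_zero_of_notMem hx]
      simp only [_root_.zero_apply, mul_zero, zero_mul, add_zero,
        intervalIntegral.integral_zero, norm_zero]
      positivity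
    obtain ⟨b1, b2, b3, b4, b5⟩ := hR x hx
    have hrx := hr0 x (hζΩ hx)
    have hpt : ∀ t, ‖χ t * (Real.exp (r x * Real.log t) *
        ((r x + 1) * fderiv ℝ ζ x e + ζ x * fderiv ℝ r x e * (1 + (r x + 1) * Real.log t)))‖ ≤
        (Icc (-ε) ε).indicator (fun _ => B) t := by
      intro t
      by_cases ht : |t| ≤ ε
      swap
      · rw [hχε t (not_le.mp ht), zero_mul, norm_zero]
        exact indicator_nonneg (fun _ _ => hB) _
      rw [indicator_of_mem (mem_Icc.mpr (abs_le.mp ht))]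
      by_cases ht0 : t = 0
      · rw [ht0, image_eq_zero_of_notMem_tsupport hχ0, zero_mul, norm_zero]; exact hB
      have htp : 0 < |t| := abs_pos.mpr ht0
      have hexp : Real.exp (r x * Real.log t) = |t| ^ r x := by
        rw [Real.rpow_def_of_pos htp, Real.log_abs, mul_comm]
      have l1 : |t| ^ r x ≤ 1 := Real.rpow_le_one htp.le (ht.trans hε1) hrx.le
      have l0 : 0 ≤ |t| ^ r x := by positivity
      -- The logarithm is controlled by 1/r alone, independently of χ; this is why R also bounds the
      -- inverse of r on the support of ζ.
      have l2 : |Real.log t| * |t| ^ r x ≤ R := by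
        have := (Real.abs_log_mul_self_rpow_lt |t| (r x) htp (ht.trans hε1) hrx).le
        rw [abs_mul, Real.log_abs, abs_of_nonneg l0, one_div] at this
        exact this.trans ((le_abs_self _).trans b5)
      have hr1 : |r x + 1| ≤ R + 1 := (abs_add_le _ _).trans (by simpa using b1)
      rw [hexp, Real.norm_eq_abs, show χ t * (|t| ^ r x * ((r x + 1) * fderiv ℝ ζ x e +
        ζ x * fderiv ℝ r x e * (1 + (r x + 1) * Real.log t))) =
        χ t * ((r x + 1) * fderiv ℝ ζ x e * |t| ^ r x + ζ x * fderiv ℝ r x e *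
          (|t| ^ r x + (r x + 1) * (Real.log t * |t| ^ r x))) by ring, abs_mul]
      refine (mul_le_of_le_one_left (abs_nonneg _) (hχb t)).trans ?_
      refine (abs_add_le _ _).trans (add_le_add ?_ ?_)
      · rw [abs_mul, abs_mul, abs_of_nonneg l0]
        calc _ ≤ (R + 1) * R * 1 := by gcongr
          _ = _ := mul_one _
      · rw [abs_mul, abs_mul]
        have : |(|t| ^ r x + (r x + 1) * (Real.log t * |t| ^ r x))| ≤ 1 + (R + 1) * R := by
          refine (abs_add_le _ _).trans ?_
          rw [abs_mul, abs_mul, abs_of_nonneg l0]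
          gcongr
        gcongr
    have hI : Integrable ((Icc (-ε) ε).indicator fun _ => B) :=
      (integrable_indicator_iff measurableSet_Icc).mpr (integrableOn_const (by simp))
    calc _ ≤ ∫ t in uIoc 0 (u x), (Icc (-ε) ε).indicator (fun _ => B) t := by
          rw [intervalIntegral.norm_intervalIntegral_eq]
          exact norm_integral_le_of_norm_le hI.integrableOn (Filter.Eventually.of_forall hpt)
      _ ≤ ∫ t, (Icc (-ε) ε).indicator (fun _ => B) t :=
          setIntegral_le_integral hI
            (Filter.Eventually.of_forall fun t => indicator_nonneg (fun _ _ => hB) _)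
      _ = B * 2 * ε := by
          rw [integral_indicator measurableSet_Icc, setIntegral_const, measureReal_def,
            Real.volume_Icc, ENNReal.toReal_ofReal (by linarith), smul_eq_mul]
          ring
  refine (norm_setIntegral_le_of_norm_le_const (lt_top_iff_ne_top.mpr hfin)
    fun x _ => hbound x).trans (le_of_eq (by ring))


/-! ### Cutoffs, signed powers and the exponents. -/

variable {γ β θ : E n → ℝ}

section Cutoff

/-- A continuous cutoff, equal to `1` for `|t| ≤ ε / 2` and to `0` for `|t| ≥ ε`. -/
noncomputable def bumpNear (ε t : ℝ) : ℝ := max 0 (min 1 (2 - 2 * |t| / ε))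

/-- A continuous cutoff, equal to `0` for `|t| ≤ δ` and to `1` for `|t| ≥ 2 δ`. -/
noncomputable def cutFar (δ t : ℝ) : ℝ := max 0 (min 1 (|t| / δ - 1))

lemma continuous_bumpNear (ε : ℝ) : Continuous (bumpNear ε) := by
  unfold bumpNear; fun_prop

lemma continuous_cutFar (δ : ℝ) : Continuous (cutFar δ) := by
  unfold cutFar; fun_prop

lemma abs_clamp_le (a : ℝ) : |max 0 (min 1 a)| ≤ 1 := by
  rw [abs_of_nonneg (le_max_left _ _)]
  exact max_le zero_le_one (min_le_left _ _)

lemma bumpNear_eq_zero {ε t : ℝ} (hε : 0 < ε) (h : ε ≤ |t|) : bumpNear ε t = 0 := by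
  refine max_eq_left ((min_le_right _ _).trans ?_)
  have : 1 ≤ |t| / ε := (one_le_div hε).mpr h
  rw [mul_div_assoc]; linarith

lemma bumpNear_zero (ε : ℝ) : bumpNear ε 0 = 1 := by
  simp [bumpNear]

lemma cutFar_eq_zero {δ t : ℝ} (hδ : 0 < δ) (h : |t| ≤ δ) : cutFar δ t = 0 := by
  refine max_eq_left ((min_le_right _ _).trans ?_)
  have : |t| / δ ≤ 1 := (div_le_one hδ).mpr h
  linarith

lemma cutFar_eq_one {δ t : ℝ} (hδ : 0 < δ) (h : 2 * δ ≤ |t|) : cutFar δ t = 1 := by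
  have : 2 ≤ |t| / δ := (le_div_iff₀ hδ).mpr h
  rw [cutFar, min_eq_left (by linarith), max_eq_right zero_le_one]

lemma tendsto_small : Filter.Tendsto (fun j : ℕ => 1 / ((j : ℝ) + 1)) Filter.atTop (nhds 0) :=
  tendsto_one_div_add_atTop_nhds_zero_nat

lemma tendsto_cutFar (t : ℝ) : Filter.Tendsto (fun j : ℕ => cutFar (1 / ((j : ℝ) + 1)) t)
    Filter.atTop (nhds (if t = 0 then 0 else 1)) := by
  split_ifs with h
  · refine tendsto_const_nhds.congr fun j => (cutFar_eq_zero (by positivity) ?_).symm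
    rw [h, abs_zero]; positivity
  · refine tendsto_const_nhds.congr' ?_
    have : 0 < |t| / 2 := by positivity
    filter_upwards [tendsto_small.eventually (gt_mem_nhds this)] with j hj
    exact (cutFar_eq_one (by positivity) (by linarith)).symm

lemma tendsto_bumpNear (t : ℝ) : Filter.Tendsto (fun j : ℕ => bumpNear (1 / ((j : ℝ) + 1)) t)
    Filter.atTop (nhds (if t = 0 then 1 else 0)) := by
  split_ifs with h
  · simp only [h, bumpNear_zero]; exact tendsto_const_nhds
  · refine tendsto_const_nhds.congr' ?_
    filter_upwards [tendsto_small.eventually (gt_mem_nhds (abs_pos.mpr h))] with j hj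
    exact (bumpNear_eq_zero (by positivity) hj.le).symm

end Cutoff

section SignedPower

lemma abs_rpow_mul_self {a : ℝ} (ha : a + 1 ≠ 0) (t : ℝ) : |(|t| ^ a * t)| = |t| ^ (a + 1) := by
  by_cases ht : t = 0
  · simp [ht, Real.zero_rpow ha]
  · have : 0 < |t| := abs_pos.mpr ht
    rw [abs_mul, abs_of_nonneg (by positivity), Real.rpow_add_one this.ne']

/-- The function |t|^a t is the odd power of degree a + 1, and degrees multiply under composition.
-/
lemma rpow_mul_self_comp {a b : ℝ} (h : (a + 1) * (b + 1) = 1) (t : ℝ) :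
    |(|t| ^ b * t)| ^ a * (|t| ^ b * t) = t := by
  by_cases ht : t = 0
  · simp [ht]
  have ht' : 0 < |t| := abs_pos.mpr ht
  have hb : b + 1 ≠ 0 := right_ne_zero_of_mul (h ▸ one_ne_zero)
  rw [abs_rpow_mul_self hb, ← Real.rpow_mul ht'.le, ← mul_assoc, ← Real.rpow_add ht',
    show (b + 1) * a + b = 0 by linarith, Real.rpow_zero, one_mul]

/-- The exponent a may be negative, as for `phiInv`; continuity at 0 is read off from the absolute
value |t|^{a+1}. -/
lemma continuous_rpow_mul_self {a : ℝ} (ha : 0 < a + 1) : Continuous fun t : ℝ => |t| ^ a * t := by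
  rw [continuous_iff_continuousAt]
  intro t
  by_cases ht : t = 0
  · subst ht
    rw [ContinuousAt, mul_zero, tendsto_zero_iff_abs_tendsto_zero]
    have : Filter.Tendsto (fun t : ℝ => |t| ^ (a + 1)) (nhds 0) (nhds (|0| ^ (a + 1))) :=
      (continuous_abs.tendsto 0).rpow_const (Or.inr ha.le)
    rw [abs_zero, Real.zero_rpow ha.ne'] at this
    exact this.congr fun s => (abs_rpow_mul_self ha.ne' s).symm
  · exact (continuous_abs.continuousAt.rpow_const (Or.inl (abs_ne_zero.mpr ht))).mul
      continuousAt_id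

end SignedPower

/-- The inverse `s ↦ |s|^{-γ/(γ+β)} s` of `φ(x, ·)`. -/
noncomputable def phiInv (γ β : E n → ℝ) (x : E n) (s : ℝ) : ℝ := |s| ^ (-(γ x / (γ x + β x))) * s

section Pointwise

variable {x : E n}

lemma phiInv_phi (hγ : 1 ≤ γ x) (hβ : 1 ≤ β x) (t : ℝ) : phiInv γ β x (phi γ β x t) = t := by
  refine rpow_mul_self_comp ?_ t
  have : γ x + β x ≠ 0 := by linarith
  have : β x ≠ 0 := by linarith
  field_simp; ring

lemma phi_phiInv (hγ : 1 ≤ γ x) (hβ : 1 ≤ β x) (t : ℝ) : phi γ β x (phiInv γ β x t) = t := by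
  refine rpow_mul_self_comp ?_ t
  have : γ x + β x ≠ 0 := by linarith
  have : β x ≠ 0 := by linarith
  field_simp; ring

lemma continuous_phiInv (hγ : 1 ≤ γ x) (hβ : 1 ≤ β x) : Continuous (phiInv γ β x) := by
  refine continuous_rpow_mul_self ?_
  have : γ x / (γ x + β x) < 1 := (div_lt_one (by linarith)).mpr (by linarith)
  linarith

/-- The reason for the choice of ψ: (γ/β + 1) ψ = θ, so the L^ψ modular of φ(u) is the L^θ modular
of u. -/
lemma abs_phi_rpow_psi (hγ : 1 ≤ γ x) (hβ : 1 ≤ β x) (t : ℝ) :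
    |phi γ β x t| ^ psi γ β θ x = |t| ^ θ x := by
  have h1 : 0 < γ x / β x := div_pos (by linarith) (by linarith)
  rw [phi, abs_rpow_mul_self (by linarith), ← Real.rpow_mul (abs_nonneg _)]
  congr 1
  have : γ x + β x ≠ 0 := by linarith
  have : β x ≠ 0 := by linarith
  rw [psi]; field_simp

lemma phiT_zero (hγ : 1 ≤ γ x) (hβ : 1 ≤ β x) : phiT γ β x 0 = 0 := by
  have h1 : 0 < γ x / β x := div_pos (by linarith) (by linarith)
  rw [phiT, abs_zero, Real.zero_rpow h1.ne', mul_zero]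

lemma rpow_le_phiT (hγ : 1 ≤ γ x) (hβ : 1 ≤ β x) (t : ℝ) :
    |t| ^ (γ x / β x) ≤ phiT γ β x t := by
  have h1 : 0 < γ x / β x := div_pos (by linarith) (by linarith)
  exact le_mul_of_one_le_left (by positivity) (by linarith)

lemma phiT_pos (hγ : 1 ≤ γ x) (hβ : 1 ≤ β x) {t : ℝ} (ht : t ≠ 0) : 0 < phiT γ β x t :=
  (Real.rpow_pos_of_pos (abs_pos.mpr ht) _).trans_le (rpow_le_phiT hγ hβ t)

lemma phiT_le (hγ : 1 ≤ γ x) (hβ : 1 ≤ β x) {C : ℝ} (hC : γ x ≤ C) (t : ℝ) :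
    phiT γ β x t ≤ (C + 1) * |t| ^ (γ x / β x) := by
  refine mul_le_mul_of_nonneg_right ?_ (by positivity)
  have : γ x / β x ≤ γ x := div_le_self (by linarith) hβ
  linarith

lemma rpow_mul_rpow_eq (hβ : 1 ≤ β x) (t s : ℝ) :
    |t| ^ γ x * |s| ^ β x = |(|t| ^ (γ x / β x) * s)| ^ β x := by
  have h : 0 < β x := by linarith
  rw [abs_mul, abs_of_nonneg (by positivity : 0 ≤ |t| ^ (γ x / β x)),
    Real.mul_rpow (by positivity) (abs_nonneg _), ← Real.rpow_mul (abs_nonneg _),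
    div_mul_cancel₀ _ h.ne']

lemma continuous_phiT (hγ : 1 ≤ γ x) (hβ : 1 ≤ β x) : Continuous (phiT γ β x) := by
  have h1 : 0 < γ x / β x := div_pos (by linarith) (by linarith)
  exact continuous_const.mul (continuous_abs.rpow_const fun _ => Or.inr h1.le)

end Pointwise

section Measurability

variable {u : E n → ℝ}

lemma aemeasurable_phi (hγ : IsExponent Ω γ) (hβ : IsExponent Ω β)
    (hu : AEMeasurable u (volume.restrict Ω)) :
    AEMeasurable (fun x => phi γ β x (u x)) (volume.restrict Ω) :=
  ((measurable_norm.comp_aemeasurable hu).pow (hγ.aemeasurable.div hβ.aemeasurable)).mul hu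

lemma aemeasurable_phiInv (hγ : IsExponent Ω γ) (hβ : IsExponent Ω β)
    (hu : AEMeasurable u (volume.restrict Ω)) :
    AEMeasurable (fun x => phiInv γ β x (u x)) (volume.restrict Ω) :=
  ((measurable_norm.comp_aemeasurable hu).pow
    (hγ.aemeasurable.div (hγ.aemeasurable.add hβ.aemeasurable)).neg).mul hu

lemma aemeasurable_phiT (hγ : IsExponent Ω γ) (hβ : IsExponent Ω β)
    (hu : AEMeasurable u (volume.restrict Ω)) :
    AEMeasurable (fun x => phiT γ β x (u x)) (volume.restrict Ω) :=
  ((hγ.aemeasurable.div hβ.aemeasurable).add_const 1).mul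
    ((measurable_norm.comp_aemeasurable hu).pow (hγ.aemeasurable.div hβ.aemeasurable))

end Measurability

lemma isExponent_psi (hγ : IsExponent Ω γ) (hβ : IsExponent Ω β) (hθ : IsExponent Ω θ)
    (hgap : ∀ᵐ x ∂volume.restrict Ω, γ x + β x ≤ θ x) : IsExponent Ω (psi γ β θ) := by
  refine ⟨(hθ.aemeasurable.mul hβ.aemeasurable).div (hγ.aemeasurable.add hβ.aemeasurable), ?_, ?_⟩
  · filter_upwards [hγ.one_le, hβ.one_le, hgap] with x h1 h2 h3
    rw [psi, one_le_div (by linarith)]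
    nlinarith
  · obtain ⟨C, hC⟩ := hθ.bounded
    refine ⟨C, ?_⟩
    filter_upwards [hγ.one_le, hβ.one_le, hgap, hC] with x h1 h2 h3 h4
    refine le_trans ?_ h4
    rw [psi, div_le_iff₀ (by linarith)]
    nlinarith

/-- The set where a continuous p is below 1 is open and null, hence empty. Pointwise bounds are
needed to differentiate γ/β and to bound its inverse on compact sets. -/
lemma IsExponent.one_le_of_mem (hΩ : IsOpen Ω) {p : E n → ℝ} (hp : IsExponent Ω p)
    (hc : ContinuousOn p Ω) {x : E n} (hx : x ∈ Ω) : 1 ≤ p x := by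
  by_contra! h
  have hopen : IsOpen (Ω ∩ p ⁻¹' Iio 1) := hc.isOpen_inter_preimage hΩ isOpen_Iio
  have hpos := hopen.measure_pos volume ⟨x, hx, h⟩
  have h1 := (ae_restrict_iff' hΩ.measurableSet).mp hp.one_le
  refine hpos.ne' (measure_mono_null ?_ h1)
  rintro y ⟨hy, hy1⟩ h2
  exact absurd (h2 hy) (not_le.mpr hy1)

/-! ### Passage to the limit in generalized derivatives. -/

/-- Bounded a.e. convergence times `L¹` convergence. -/
lemma tendsto_integral_mul_of_bounded {α : Type*} [MeasurableSpace α] {μ : Measure α}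
    {h W : ℕ → α → ℝ} {k w : α → ℝ} {M : ℝ} (hm : ∀ j, AEStronglyMeasurable (h j) μ)
    (hM : ∀ j, ∀ᵐ x ∂μ, |h j x| ≤ M)
    (hk : ∀ᵐ x ∂μ, Filter.Tendsto (fun j => h j x) Filter.atTop (nhds (k x)))
    (hW : ∀ j, Integrable (W j) μ) (hw : Integrable w μ)
    (hWw : Filter.Tendsto (fun j => eLpNorm (W j - w) 1 μ) Filter.atTop (nhds 0)) :
    Filter.Tendsto (fun j => ∫ x, h j x * W j x ∂μ) Filter.atTop
      (nhds (∫ x, k x * w x ∂μ)) := by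
  have t1 : Filter.Tendsto (fun j => ∫ x, h j x * w x ∂μ) Filter.atTop
      (nhds (∫ x, k x * w x ∂μ)) := by
    refine tendsto_integral_of_dominated_convergence (fun x => M * |w x|)
      (fun j => (hm j).mul hw.aestronglyMeasurable) (hw.abs.const_mul M) (fun j => ?_) ?_
    · filter_upwards [hM j] with x hx
      rw [norm_mul, Real.norm_eq_abs, Real.norm_eq_abs]
      gcongr
    · filter_upwards [hk] with x hx using hx.mul_const _
  have t2 : Filter.Tendsto (fun j => ∫ x, h j x * (W j x - w x) ∂μ) Filter.atTop (nhds 0) := by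
    have e1 : ∀ j, (eLpNorm (W j - w) 1 μ).toReal = ∫ x, |W j x - w x| ∂μ := by
      intro j
      rw [eLpNorm_one_eq_lintegral_enorm]
      exact (integral_norm_eq_lintegral_enorm ((hW j).sub hw).aestronglyMeasurable).symm
    have t3 : Filter.Tendsto (fun j => M * ∫ x, |W j x - w x| ∂μ) Filter.atTop (nhds 0) := by
      have := ((ENNReal.tendsto_toReal ENNReal.zero_ne_top).comp hWw).const_mul M
      simpa [Function.comp_def, e1] using this
    refine squeeze_zero_norm (fun j => ?_) t3
    rw [← integral_const_mul]
    refine norm_integral_le_of_norm_le (((hW j).sub hw).abs.const_mul M) ?_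
    filter_upwards [hM j] with x hx
    rw [norm_mul, Real.norm_eq_abs, Real.norm_eq_abs]
    gcongr
  have t4 := t2.add t1
  rw [zero_add] at t4
  refine t4.congr fun j => ?_
  have i1 : Integrable (fun x => h j x * (W j x - w x)) μ :=
    ((hW j).sub hw).bdd_mul (hm j) (hM j)
  have i2 : Integrable (fun x => h j x * w x) μ := hw.bdd_mul (hm j) (hM j)
  rw [← integral_add i1 i2]
  congr 1; funext x; ring


/-- The limit of `φ'_t(u_m) D_i u_m` vanishes on the zero set of the limit of `u_m`. -/
lemma ae_eq_zero_of_tendsto (hΩ : IsOpen Ω) (hfin : volume Ω ≠ ⊤) (hγ : IsExponent Ω γ)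
    (hβ : IsExponent Ω β) (hγ1 : ContDiffOn ℝ 1 γ Ω) (hβ1 : ContDiffOn ℝ 1 β Ω) {i : Fin n}
    {U D : ℕ → E n → ℝ} {u w : E n → ℝ} (hU : ∀ m, AEMeasurable (U m) (volume.restrict Ω))
    (hD : ∀ m, IsGenPartial Ω (U m) i (D m)) (hu : AEMeasurable u (volume.restrict Ω))
    (hlim : ∀ᵐ x ∂volume.restrict Ω, Filter.Tendsto (fun m => U m x) Filter.atTop (nhds (u x)))
    (hW : ∀ m, IntegrableOn (fun x => phiT γ β x (U m x) * D m x) Ω) (hw : IntegrableOn w Ω)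
    (hWw : Filter.Tendsto (fun m => eLpNorm ((fun x => phiT γ β x (U m x) * D m x) - w) 1
      (volume.restrict Ω)) Filter.atTop (nhds 0)) :
    ∀ᵐ x ∂volume.restrict Ω, u x = 0 → w x = 0 := by
  have g1 : ∀ x ∈ Ω, 1 ≤ γ x := fun x hx => hγ.one_le_of_mem hΩ hγ1.continuousOn hx
  have b1 : ∀ x ∈ Ω, 1 ≤ β x := fun x hx => hβ.one_le_of_mem hΩ hβ1.continuousOn hx
  set r : E n → ℝ := fun x => γ x / β x
  have hr : ContDiffOn ℝ 1 r Ω := hγ1.div hβ1 fun x hx => by linarith [b1 x hx]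
  have hr0 : ∀ x ∈ Ω, 0 < r x := fun x hx =>
    div_pos (by linarith [g1 x hx]) (by linarith [b1 x hx])
  -- With the indicator of {0}, the claim becomes c(u) w = 0 a.e., which can be tested against
  -- smooth ζ.
  set c : ℝ → ℝ := fun t => if t = 0 then 1 else 0
  have hcm : Measurable c := Measurable.ite (measurableSet_singleton 0) measurable_const
    measurable_const
  have hc1 : ∀ t, |c t| ≤ 1 := by
    intro t; simp only [c]; split_ifs <;> simp
  have hcw : IntegrableOn (fun x => c (u x) * w x) Ω :=
    hw.bdd_mul (hcm.comp_aemeasurable hu).aestronglyMeasurable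
      (Filter.Eventually.of_forall fun x => hc1 (u x))
  have key : ∀ᵐ x ∂volume, x ∈ Ω → c (u x) * w x = 0 := by
    refine hΩ.ae_eq_zero_of_integral_contDiff_smul_eq_zero hcw.locallyIntegrableOn ?_
    intro ζ hζ hζ1 hζΩ
    obtain ⟨B, hB⟩ := hζ1.exists_bound_of_continuous hζ.continuous
    have hζ' : ContDiff ℝ 1 ζ := hζ.of_le (by exact_mod_cast le_top)
    obtain ⟨C, hC0, hC⟩ := exists_integral_rpow_le hΩ hfin hr hr0 hζ' hζ1 hζΩ i
    have hbound : ∀ (f : E n → ℝ) (χ : ℝ → ℝ), (∀ t, |χ t| ≤ 1) → ∀ x,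
        |χ (f x) * ζ x| ≤ B := by
      intro f χ hχ x
      rw [abs_mul]
      exact (mul_le_of_le_one_left (abs_nonneg _) (hχ _)).trans (hB x)
    -- The O(ε) estimate requires a cutoff vanishing near 0, so `bumpNear` is multiplied by `cutFar`
    -- at scale δ and δ is sent to 0 with m fixed.
    have step1 : ∀ (ε : ℝ), 0 < ε → ε ≤ 1 → ∀ m,
        |∫ x in Ω, (bumpNear ε (U m x) * ζ x) * (phiT γ β x (U m x) * D m x)| ≤ C * ε := by
      intro ε hε hε1 m
      have hχb : ∀ δ t, |bumpNear ε t * cutFar δ t| ≤ 1 := by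
        intro δ t
        rw [abs_mul]
        exact mul_le_one₀ (abs_clamp_le _) (abs_nonneg _) (abs_clamp_le _)
      have hχc : ∀ δ, Continuous fun t => bumpNear ε t * cutFar δ t := fun δ =>
        (continuous_bumpNear ε).mul (continuous_cutFar δ)
      have hlim1 := tendsto_integral_mul_of_bounded (μ := volume.restrict Ω)
        (h := fun j x => bumpNear ε (U m x) * cutFar (1 / ((j : ℝ) + 1)) (U m x) * ζ x)
        (W := fun _ x => phiT γ β x (U m x) * D m x)
        (k := fun x => bumpNear ε (U m x) * (if U m x = 0 then 0 else 1) * ζ x)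
        (w := fun x => phiT γ β x (U m x) * D m x) (M := B)
        (fun j => (((hχc _).measurable.comp_aemeasurable (hU m)).aestronglyMeasurable.mul
          hζ.continuous.aestronglyMeasurable))
        (fun j => Filter.Eventually.of_forall fun x => hbound (U m) _ (hχb _) x)
        (Filter.Eventually.of_forall fun x =>
          ((tendsto_cutFar (U m x)).const_mul _).mul_const _)
        (fun _ => hW m) (hW m) (by simp)
      -- Removing the zero set of u_m costs nothing, because φ'_t(x, 0) = 0.
      have e1 : ∫ x in Ω, (bumpNear ε (U m x) * ζ x) * (phiT γ β x (U m x) * D m x) =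
          ∫ x in Ω, bumpNear ε (U m x) * (if U m x = 0 then 0 else 1) * ζ x *
            (phiT γ β x (U m x) * D m x) := by
        refine setIntegral_congr_fun hΩ.measurableSet fun x hx => ?_
        by_cases h0 : U m x = 0
        · simp [h0, phiT_zero (g1 x hx) (b1 x hx)]
        · simp [h0]
      rw [e1]
      refine le_of_tendsto hlim1.abs (Filter.Eventually.of_forall fun j => ?_)
      have hδ : (0 : ℝ) < 1 / ((j : ℝ) + 1) := by positivity
      have hsub : tsupport (fun t => bumpNear ε t * cutFar (1 / ((j : ℝ) + 1)) t) ⊆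
          {t | 1 / ((j : ℝ) + 1) ≤ |t|} := by
        refine closure_minimal (fun t ht => ?_) (isClosed_le continuous_const continuous_abs)
        by_contra h
        exact ht (by simp only [cutFar_eq_zero hδ (not_le.mp h).le, mul_zero])
      have := hC (U m) (D m) (hU m) (hD m) (fun t => bumpNear ε t * cutFar (1 / ((j : ℝ) + 1)) t)
        ε (hχc _) (HasCompactSupport.intro (isCompact_closedBall 0 ε) fun t ht => ?_)
        (fun h => ?_) (hχb _) hε hε1 (fun t ht => ?_)
      · refine le_trans (le_of_eq ?_) this
        congr 2; funext x
        simp only [phiT, r]; ring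
      · have : ε < |t| := by simpa [Real.dist_eq] using ht
        simp only [bumpNear_eq_zero hε this.le, zero_mul]
      · have := hsub h
        simp only [mem_ofPred_eq, abs_zero] at this
        linarith
      · simp only [bumpNear_eq_zero hε ht.le, zero_mul]
    -- The bound is uniform in m, so it survives m → ∞ with ε fixed.
    have step2 : ∀ (ε : ℝ), 0 < ε → ε ≤ 1 →
        |∫ x in Ω, (bumpNear ε (u x) * ζ x) * w x| ≤ C * ε := by
      intro ε hε hε1
      have hlim2 := tendsto_integral_mul_of_bounded (μ := volume.restrict Ω)
        (h := fun m x => bumpNear ε (U m x) * ζ x)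
        (W := fun m x => phiT γ β x (U m x) * D m x)
        (k := fun x => bumpNear ε (u x) * ζ x) (w := w) (M := B)
        (fun m => (((continuous_bumpNear ε).measurable.comp_aemeasurable
          (hU m)).aestronglyMeasurable.mul hζ.continuous.aestronglyMeasurable))
        (fun m => Filter.Eventually.of_forall fun x =>
          hbound (U m) _ (fun _ => abs_clamp_le _) x)
        (by
          filter_upwards [hlim] with x hx
          exact (((continuous_bumpNear ε).tendsto _).comp hx).mul_const _)
        hW hw hWw
      exact le_of_tendsto hlim2.abs (Filter.Eventually.of_forall fun m => step1 ε hε hε1 m)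
    -- Finally ε → 0, where the bumps shrink to the indicator of {u = 0}.
    have hlim3 := tendsto_integral_mul_of_bounded (μ := volume.restrict Ω)
      (h := fun j x => bumpNear (1 / ((j : ℝ) + 1)) (u x) * ζ x) (W := fun _ => w)
      (k := fun x => c (u x) * ζ x) (w := w) (M := B)
      (fun j => (((continuous_bumpNear _).measurable.comp_aemeasurable
          hu).aestronglyMeasurable.mul hζ.continuous.aestronglyMeasurable))
      (fun j => Filter.Eventually.of_forall fun x => hbound u _ (fun _ => abs_clamp_le _) x)
      (Filter.Eventually.of_forall fun x => (tendsto_bumpNear (u x)).mul_const _)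
      (fun _ => hw) hw (by simp)
    have hzero : |∫ x in Ω, c (u x) * ζ x * w x| ≤ 0 := by
      have h2 := tendsto_small.const_mul C
      rw [mul_zero] at h2
      refine le_of_tendsto_of_tendsto hlim3.abs h2 (Filter.Eventually.of_forall fun j => ?_)
      refine step2 _ (by positivity) ?_
      rw [div_le_one (by positivity)]
      linarith [(Nat.cast_nonneg j : (0 : ℝ) ≤ j)]
    rw [← setIntegral_eq_integral_of_forall_compl_eq_zero (s := Ω)]
    · rw [← abs_nonpos_iff.mp hzero]
      congr 1; funext x
      simp only [smul_eq_mul]; ring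
    · intro x hx
      simp [image_eq_zero_of_notMem_tsupport fun h => hx (hζΩ h)]
  rw [ae_restrict_iff' hΩ.measurableSet]
  filter_upwards [key] with x hx hxΩ h0
  have := hx hxΩ
  simpa [c, h0] using this

/-- Generalized derivatives pass to the limit when `u_m → u` a.e. and
`φ'_t(u_m) D_i u_m` converges in `L¹`. -/
lemma isGenPartial_of_tendsto (hfin : volume Ω ≠ ⊤) (hγ : IsExponent Ω γ)
    (hβ : IsExponent Ω β) {i : Fin n}
    {U D : ℕ → E n → ℝ} {u w : E n → ℝ} (hU : ∀ m, AEMeasurable (U m) (volume.restrict Ω))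
    (hD : ∀ m, IsGenPartial Ω (U m) i (D m)) (hu : AEMeasurable u (volume.restrict Ω))
    (hlim : ∀ᵐ x ∂volume.restrict Ω, Filter.Tendsto (fun m => U m x) Filter.atTop (nhds (u x)))
    (hW : ∀ m, IntegrableOn (fun x => phiT γ β x (U m x) * D m x) Ω) (hw : IntegrableOn w Ω)
    (hWw : Filter.Tendsto (fun m => eLpNorm ((fun x => phiT γ β x (U m x) * D m x) - w) 1
      (volume.restrict Ω)) Filter.atTop (nhds 0)) :
    IsGenPartial Ω u i (fun x => w x / phiT γ β x (u x)) := by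
  have hfm : IsFiniteMeasure (volume.restrict Ω) := ⟨by simpa [lt_top_iff_ne_top] using hfin⟩
  refine ⟨hw.aestronglyMeasurable.aemeasurable.div (aemeasurable_phiT hγ hβ hu), ?_, ?_⟩
  · filter_upwards [hγ.one_le, hβ.one_le] with x h1 h2 h0
    -- The convention a / 0 = 0 gives the quotient the value required of a generalized derivative on
    -- {u = 0}.
    rw [h0, phiT_zero h1 h2, div_zero]
  intro G hG hG1 hG0
  obtain ⟨M, hM⟩ := exists_bound_of_hasCompactSupport_deriv hG hG1
  set q := deriv G
  have hq : Continuous q := hG.continuous_deriv le_rfl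
  obtain ⟨Q, hQ⟩ := hG1.exists_bound_of_continuous hq
  obtain ⟨C, hC⟩ := hγ.bounded
  obtain ⟨ρ, hρ0, hρ1, hρ⟩ : ∃ ρ : ℝ, 0 < ρ ∧ ρ ≤ 1 ∧ ∀ t, |t| < ρ → q t = 0 := by
    obtain ⟨ρ, hρ0, hρ⟩ := Metric.eventually_nhds_iff.mp (notMem_tsupport_iff_eventuallyEq.mp hG0)
    refine ⟨min ρ 1, by positivity, min_le_right _ _, fun t ht => hρ ?_⟩
    rw [Real.dist_eq, sub_zero]
    exact ht.trans_le (min_le_left _ _)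
  have hQ0 : 0 ≤ Q := (norm_nonneg _).trans (hQ 0)
  -- G'(u_m) D_iu_m equals H(x, u_m) times φ'_t(u_m) D_iu_m, and H is bounded and continuous in t
  -- for a.e. x because G' vanishes on |t| < ρ.
  set H : E n → ℝ → ℝ := fun x t => q t / phiT γ β x t with hH
  have hHm : ∀ f : E n → ℝ, AEMeasurable f (volume.restrict Ω) →
      AEMeasurable (fun x => H x (f x)) (volume.restrict Ω) := fun f hf =>
    (hq.measurable.comp_aemeasurable hf).div (aemeasurable_phiT hγ hβ hf)
  have hHb : ∀ᵐ x ∂volume.restrict Ω, ∀ t, |H x t| ≤ Q / ρ ^ C := by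
    filter_upwards [hγ.one_le, hβ.one_le, hC] with x h1 h2 h3 t
    by_cases ht : |t| < ρ
    · simp only [hH, hρ t ht, zero_div, abs_zero]; positivity
    rw [not_lt] at ht
    have h4 : 0 < γ x / β x := div_pos (by linarith) (by linarith)
    have h5 : γ x / β x ≤ C := (div_le_self (by linarith) h2).trans h3
    have h6 : ρ ^ C ≤ phiT γ β x t :=
      calc ρ ^ C ≤ ρ ^ (γ x / β x) := Real.rpow_le_rpow_of_exponent_ge hρ0 hρ1 h5
        _ ≤ |t| ^ (γ x / β x) := Real.rpow_le_rpow hρ0.le ht h4.le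
        _ ≤ _ := rpow_le_phiT h1 h2 t
    rw [hH, abs_div, abs_of_pos ((Real.rpow_pos_of_pos hρ0 C).trans_le h6)]
    exact div_le_div₀ hQ0 (hQ t) (Real.rpow_pos_of_pos hρ0 C) h6
  have hHc : ∀ᵐ x ∂volume.restrict Ω, Continuous (H x) := by
    filter_upwards [hγ.one_le, hβ.one_le] with x h1 h2
    have := continuous_mul_of_notMem_tsupport hq hG0
      (h := fun t => (phiT γ β x t)⁻¹)
      ((continuous_phiT h1 h2).continuousOn.inv₀ fun t ht => (phiT_pos h1 h2 ht).ne')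
    simpa only [hH, div_eq_inv_mul] using this
  have hHw : (fun x => q (u x) * (w x / phiT γ β x (u x))) = fun x => H x (u x) * w x := by
    funext x; simp only [hH]; ring
  have hloc : IntegrableOn (fun x => H x (u x) * w x) Ω :=
    hw.bdd_mul (hHm u hu).aestronglyMeasurable (hHb.mono fun x hx => hx _)
  refine ⟨?_, ?_, ?_⟩
  · exact IntegrableOn.locallyIntegrableOn (Integrable.of_bound
      (hG.continuous.measurable.comp_aemeasurable hu).aestronglyMeasurable M
      (Filter.Eventually.of_forall fun x => hM _))
  · rw [hHw]; exact hloc.locallyIntegrableOn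
  intro η h1 h2 h3
  have h1' : ContDiff ℝ 1 η := h1.of_le (by exact_mod_cast le_top)
  obtain ⟨B, hB⟩ := h2.exists_bound_of_continuous h1.continuous
  set e : E n := EuclideanSpace.single i 1
  have hd : Continuous fun x => fderiv ℝ η x e :=
    (h1'.continuous_fderiv one_ne_zero).clm_apply continuous_const
  have hdi : Integrable fun x => fderiv ℝ η x e :=
    hd.integrable_of_hasCompactSupport (h2.fderiv_apply (𝕜 := ℝ) e)
  have lim1 : Filter.Tendsto (fun m => ∫ x in Ω, G (U m x) * fderiv ℝ η x e) Filter.atTop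
      (nhds (∫ x in Ω, G (u x) * fderiv ℝ η x e)) := by
    refine tendsto_integral_of_dominated_convergence (fun x => M * |fderiv ℝ η x e|)
      (fun m => (hG.continuous.measurable.comp_aemeasurable (hU m)).aestronglyMeasurable.mul
        hd.aestronglyMeasurable) (hdi.abs.const_mul M).integrableOn
      (fun m => Filter.Eventually.of_forall fun x => ?_) ?_
    · rw [norm_mul, Real.norm_eq_abs, Real.norm_eq_abs]
      gcongr
      exact hM _
    · filter_upwards [hlim] with x hx
      exact ((hG.continuous.tendsto _).comp hx).mul_const _
  have lim2 := tendsto_integral_mul_of_bounded (μ := volume.restrict Ω)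
    (h := fun m x => H x (U m x) * η x) (W := fun m x => phiT γ β x (U m x) * D m x)
    (k := fun x => H x (u x) * η x) (w := w) (M := Q / ρ ^ C * B)
    (fun m => (hHm _ (hU m)).aestronglyMeasurable.mul h1.continuous.aestronglyMeasurable)
    (fun m => by
      filter_upwards [hHb] with x hx
      rw [abs_mul]
      exact mul_le_mul (hx _) (hB x) (abs_nonneg _) (by positivity))
    (by
      filter_upwards [hHc, hlim] with x hx hl
      exact ((hx.tendsto _).comp hl).mul_const _)
    hW hw hWw
  have e1 : ∀ m, ∫ x in Ω, G (U m x) * fderiv ℝ η x e =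
      -∫ x in Ω, (H x (U m x) * η x) * (phiT γ β x (U m x) * D m x) := by
    intro m
    rw [((hD m).truncation G hG hG1 hG0).integral_eq η h1 h2 h3]
    congr 1
    refine integral_congr_ae ?_
    filter_upwards [hγ.one_le, hβ.one_le] with x g1 b1
    by_cases ht : U m x = 0
    · have : q 0 = 0 := hρ 0 (by simpa using hρ0)
      simp only [q] at this
      simp [hH, ht, this, q]
    · have := (phiT_pos g1 b1 ht).ne'
      change q (U m x) * D m x * η x = _
      simp only [hH]
      field_simp
  simp only [e1] at lim1
  rw [tendsto_nhds_unique lim1 lim2.neg]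
  congr 2
  funext x
  simp only [hH]; ring


/-! ### The metric and its completeness. -/

lemma genPartial_spec {u : E n → ℝ} {i : Fin n} (h : ∃ g, IsGenPartial Ω u i g) :
    IsGenPartial Ω u i (genPartial Ω u i) := by
  rw [genPartial, dif_pos h]
  exact h.choose_spec

lemma luxNorm_zero {p : E n → ℝ} (hp : IsExponent Ω p) : luxNorm Ω p (fun _ => 0) = 0 := by
  refine le_antisymm (ENNReal.le_of_forall_pos_le_add fun ε hε _ => ?_) zero_le
  rw [zero_add]
  have h0 : modular Ω p (fun _ => 0) = 0 := by
    rw [modular, lintegral_congr_ae (g := fun _ => 0), lintegral_zero]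
    filter_upwards [hp.one_le] with x hx
    rw [abs_zero, Real.zero_rpow (by linarith), ENNReal.ofReal_zero]
  refine (luxNorm_le (l := ε) (by exact_mod_cast hε) ?_).trans (by simp)
  simp [h0]

lemma modular_psi_phi (hγ : IsExponent Ω γ) (hβ : IsExponent Ω β) (u : E n → ℝ) :
    modular Ω (psi γ β θ) (fun x => phi γ β x (u x)) = modular Ω θ u := by
  refine lintegral_congr_ae ?_
  filter_upwards [hγ.one_le, hβ.one_le] with x h1 h2
  rw [abs_phi_rpow_psi h1 h2]

lemma modular_phiT_mul_lt_top (hγ : IsExponent Ω γ) (hβ : IsExponent Ω β) {u g : E n → ℝ}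
    (h : ∫⁻ x in Ω, ENNReal.ofReal (|u x| ^ γ x * |g x| ^ β x) < ⊤) :
    modular Ω β (fun x => phiT γ β x (u x) * g x) < ⊤ := by
  obtain ⟨C, hC⟩ := hγ.bounded
  have h1 : modular Ω β (fun x => |u x| ^ (γ x / β x) * g x) < ⊤ := by
    refine lt_of_le_of_lt (lintegral_mono_ae ?_) h
    filter_upwards [hβ.one_le] with x hx
    rw [rpow_mul_rpow_eq hx]
  refine lt_of_le_of_lt (hβ.modular_mono ?_) (hβ.modular_const_mul_lt_top h1 (C + 1))
  filter_upwards [hγ.one_le, hβ.one_le, hC] with x g1 b1 c1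
  have h0 : 0 ≤ |u x| ^ (γ x / β x) := by positivity
  rw [abs_mul, abs_mul, abs_mul, abs_of_nonneg (h0.trans (rpow_le_phiT g1 b1 _)),
    abs_of_nonneg h0, abs_of_nonneg (by linarith : 0 ≤ C + 1), ← mul_assoc]
  exact mul_le_mul_of_nonneg_right (phiT_le g1 b1 c1 _) (abs_nonneg _)

namespace SSpace

variable (u v w : SSpace Ω γ β θ)

lemma aemeasurable : AEMeasurable u.toFun (volume.restrict Ω) :=
  (Lp.aestronglyMeasurable u.1).aemeasurable

lemma isGenPartial (i : Fin n) : IsGenPartial Ω u.toFun i (genPartial Ω u.toFun i) :=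
  genPartial_spec (u.2.1.2.1 i)

lemma modular_phi_lt_top (hγ : IsExponent Ω γ) (hβ : IsExponent Ω β) :
    modular Ω (psi γ β θ) (fun x => phi γ β x (u.toFun x)) < ⊤ := by
  rw [modular_psi_phi hγ hβ]
  exact u.2.2.2

lemma modular_grad_lt_top (hγ : IsExponent Ω γ) (hβ : IsExponent Ω β) (i : Fin n) :
    modular Ω β (fun x => phiT γ β x (u.toFun x) * genPartial Ω u.toFun i x) < ⊤ := by
  refine modular_phiT_mul_lt_top hγ hβ (lt_of_le_of_lt ?_ u.2.1.2.2)
  refine le_trans ?_ le_add_self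
  exact Finset.single_le_sum (f := fun i => ∫⁻ x in Ω, ENNReal.ofReal
    (|u.toFun x| ^ γ x * |genPartial Ω u.toFun i x| ^ β x)) (fun _ _ => zero_le)
    (Finset.mem_univ i)

lemma aemeasurable_grad (hγ : IsExponent Ω γ) (hβ : IsExponent Ω β) (i : Fin n) :
    AEMeasurable (fun x => phiT γ β x (u.toFun x) * genPartial Ω u.toFun i x)
      (volume.restrict Ω) :=
  (aemeasurable_phiT hγ hβ u.aemeasurable).mul (u.isGenPartial i).aemeasurable

lemma dS_lt_top (hγ : IsExponent Ω γ) (hβ : IsExponent Ω β)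
    (hψ : IsExponent Ω (psi γ β θ)) : dS u v < ⊤ :=
  ENNReal.add_lt_top.mpr ⟨hψ.luxNorm_sub_lt_top (aemeasurable_phi hγ hβ u.aemeasurable)
    (u.modular_phi_lt_top hγ hβ) (v.modular_phi_lt_top hγ hβ), ENNReal.sum_lt_top.mpr fun i _ =>
    hβ.luxNorm_sub_lt_top (u.aemeasurable_grad hγ hβ i) (u.modular_grad_lt_top hγ hβ i)
      (v.modular_grad_lt_top hγ hβ i)⟩

lemma dS_self (hβ : IsExponent Ω β) (hψ : IsExponent Ω (psi γ β θ)) : dS u u = 0 := by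
  simp [dS, luxNorm_zero hβ, luxNorm_zero hψ]

lemma dS_comm : dS u v = dS v u := by
  rw [dS, dS, luxNorm_sub_comm]
  congr 1
  exact Finset.sum_congr rfl fun i _ => luxNorm_sub_comm

lemma dS_triangle (hγ : IsExponent Ω γ) (hβ : IsExponent Ω β)
    (hψ : IsExponent Ω (psi γ β θ)) : dS u w ≤ dS u v + dS v w := by
  rw [dS, dS, dS, add_add_add_comm, ← Finset.sum_add_distrib]
  refine add_le_add ?_ (Finset.sum_le_sum fun i _ => ?_)
  · exact hψ.luxNorm_sub_le (aemeasurable_phi hγ hβ u.aemeasurable)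
      (aemeasurable_phi hγ hβ v.aemeasurable)
  · exact hβ.luxNorm_sub_le (u.aemeasurable_grad hγ hβ i) (v.aemeasurable_grad hγ hβ i)

lemma luxNorm_phi_le_dS : luxNorm Ω (psi γ β θ)
    (fun x => phi γ β x (u.toFun x) - phi γ β x (v.toFun x)) ≤ dS u v :=
  le_self_add

lemma luxNorm_grad_le_dS (i : Fin n) : luxNorm Ω β
    (fun x => phiT γ β x (u.toFun x) * genPartial Ω u.toFun i x -
      phiT γ β x (v.toFun x) * genPartial Ω v.toFun i x) ≤ dS u v := by
  refine le_trans ?_ le_add_self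
  exact Finset.single_le_sum (f := fun i => luxNorm Ω β
    (fun x => phiT γ β x (u.toFun x) * genPartial Ω u.toFun i x -
      phiT γ β x (v.toFun x) * genPartial Ω v.toFun i x)) (fun _ _ => zero_le) (Finset.mem_univ i)

-- The first term of the distance already separates points, since φ(x, ·) is injective.
variable {u v} in
lemma eq_of_dS_eq_zero (hΩ : volume Ω ≠ ⊤) (hγ : IsExponent Ω γ) (hβ : IsExponent Ω β)
    (hψ : IsExponent Ω (psi γ β θ)) (h : dS u v = 0) : u = v := by
  have h1 := hψ.ae_eq_zero hΩ ((aemeasurable_phi hγ hβ u.aemeasurable).sub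
    (aemeasurable_phi hγ hβ v.aemeasurable))
    (le_antisymm ((luxNorm_phi_le_dS u v).trans h.le) zero_le)
  refine Subtype.ext (Lp.ext ?_)
  filter_upwards [h1, hγ.one_le, hβ.one_le] with x hx g1 b1
  have := congrArg (phiInv γ β x) (sub_eq_zero.mp hx)
  rwa [phiInv_phi g1 b1, phiInv_phi g1 b1] at this

/-- Sequential completeness with respect to `dS`. -/
lemma exists_tendsto_dS (hΩ : IsOpen Ω) (hfin : volume Ω ≠ ⊤) (hγ : IsExponent Ω γ)
    (hβ : IsExponent Ω β) (hθ : IsExponent Ω θ) (hγ1 : ContDiffOn ℝ 1 γ Ω)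
    (hβ1 : ContDiffOn ℝ 1 β Ω) (hgap : ∀ᵐ x ∂volume.restrict Ω, γ x + β x ≤ θ x)
    (U : ℕ → SSpace Ω γ β θ)
    (hU : ∀ ε : ℝ≥0∞, 0 < ε → ∃ N, ∀ m ≥ N, ∀ k ≥ N, dS (U m) (U k) < ε) :
    ∃ u : SSpace Ω γ β θ, Filter.Tendsto (fun m => dS (U m) u) Filter.atTop (nhds 0) := by
  have hψ : IsExponent Ω (psi γ β θ) := isExponent_psi hγ hβ hθ hgap
  have hUm : ∀ m, AEMeasurable (U m).toFun (volume.restrict Ω) := fun m => (U m).aemeasurable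
  have hfm : IsFiniteMeasure (volume.restrict Ω) := ⟨by simpa [lt_top_iff_ne_top] using hfin⟩
  obtain ⟨v, hvm, hvmod, hv⟩ := hψ.exists_tendsto_luxNorm hfin
    (fun m => aemeasurable_phi hγ hβ (hUm m)) (fun m => (U m).modular_phi_lt_top hγ hβ)
    (fun ε hε => (hU ε hε).imp fun N hN m hm k hk =>
      (luxNorm_phi_le_dS _ _).trans_lt (hN m hm k hk))
  have hgrad : ∀ i : Fin n, ∃ w : E n → ℝ, AEMeasurable w (volume.restrict Ω) ∧
      modular Ω β w < ⊤ ∧ Filter.Tendsto (fun m => luxNorm Ω β (fun x =>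
        phiT γ β x ((U m).toFun x) * genPartial Ω (U m).toFun i x - w x)) Filter.atTop
        (nhds 0) := fun i =>
    hβ.exists_tendsto_luxNorm hfin (fun m => (U m).aemeasurable_grad hγ hβ i)
      (fun m => (U m).modular_grad_lt_top hγ hβ i)
      (fun ε hε => (hU ε hε).imp fun N hN m hm k hk =>
        (luxNorm_grad_le_dS _ _ i).trans_lt (hN m hm k hk))
  choose w hwm hwmod hw using hgrad
  -- The subsequence serves only to identify the limits; v and each w i are already limits of the
  -- full sequences.
  obtain ⟨ns, hns, hae⟩ := (tendstoInMeasure_of_tendsto_eLpNorm one_ne_zero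
    (fun m => (aemeasurable_phi hγ hβ (hUm m)).aestronglyMeasurable) hvm.aestronglyMeasurable
    (hψ.tendsto_eLpNorm hfin hv)).exists_seq_tendsto_ae
  -- the limit function
  set u₀ : E n → ℝ := fun x => phiInv γ β x (v x)
  have hφu₀ : ∀ᵐ x ∂volume.restrict Ω, phi γ β x (u₀ x) = v x := by
    filter_upwards [hγ.one_le, hβ.one_le] with x g1 b1 using phi_phiInv g1 b1 _
  have hθu₀ : modular Ω θ u₀ < ⊤ := by
    rw [← modular_psi_phi hγ hβ, modular_congr hφu₀]
    exact hvmod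
  have hmem : MemLp u₀ 1 (volume.restrict Ω) :=
    hθ.memLp_one hfin (aemeasurable_phiInv hγ hβ hvm) hθu₀
  set u : Lp ℝ 1 (volume.restrict Ω) := hmem.toLp u₀
  have huu₀ : ∀ᵐ x ∂volume.restrict Ω, u x = u₀ x := hmem.coeFn_toLp
  have hum : AEMeasurable u (volume.restrict Ω) := (Lp.aestronglyMeasurable u).aemeasurable
  have hφu : ∀ᵐ x ∂volume.restrict Ω, phi γ β x (u x) = v x := by
    filter_upwards [huu₀, hφu₀] with x h1 h2
    rw [h1, h2]
  have hθu : modular Ω θ u < ⊤ := by rwa [modular_congr huu₀]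
  have hlim : ∀ᵐ x ∂volume.restrict Ω,
      Filter.Tendsto (fun j => (U (ns j)).toFun x) Filter.atTop (nhds (u x)) := by
    filter_upwards [hae, hγ.one_le, hβ.one_le, huu₀] with x hx g1 b1 h0
    rw [h0]
    have := ((continuous_phiInv g1 b1).tendsto _).comp hx
    simpa only [Function.comp_def, phiInv_phi g1 b1] using this
  have hWint : ∀ i j, IntegrableOn (fun x => phiT γ β x ((U (ns j)).toFun x) *
      genPartial Ω (U (ns j)).toFun i x) Ω := fun i j =>
    memLp_one_iff_integrable.mp (hβ.memLp_one hfin ((U _).aemeasurable_grad hγ hβ i)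
      ((U _).modular_grad_lt_top hγ hβ i))
  have hwint : ∀ i, IntegrableOn (w i) Ω := fun i =>
    memLp_one_iff_integrable.mp (hβ.memLp_one hfin (hwm i) (hwmod i))
  have hWw : ∀ i, Filter.Tendsto (fun j => eLpNorm ((fun x =>
      phiT γ β x ((U (ns j)).toFun x) * genPartial Ω (U (ns j)).toFun i x) - w i) 1
      (volume.restrict Ω)) Filter.atTop (nhds 0) := fun i =>
    (hβ.tendsto_eLpNorm hfin (hw i)).comp hns.tendsto_atTop
  have hgen : ∀ i, IsGenPartial Ω u i (fun x => w i x / phiT γ β x (u x)) := fun i =>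
    isGenPartial_of_tendsto hfin hγ hβ (fun j => hUm (ns j))
      (fun j => (U (ns j)).isGenPartial i) hum hlim (hWint i) (hwint i) (hWw i)
  -- Dividing w by φ'_t(u) loses the values of w on {u = 0}; this is what makes multiplication by
  -- φ'_t(u) recover w there.
  have hzero : ∀ i, ∀ᵐ x ∂volume.restrict Ω, u x = 0 → w i x = 0 := fun i =>
    ae_eq_zero_of_tendsto hΩ hfin hγ hβ hγ1 hβ1 (fun j => hUm (ns j))
      (fun j => (U (ns j)).isGenPartial i) hum hlim (hWint i) (hwint i) (hWw i)
  have hWu : ∀ i, ∀ᵐ x ∂volume.restrict Ω,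
      phiT γ β x (u x) * genPartial Ω u i x = w i x := by
    intro i
    filter_upwards [(genPartial_spec ⟨_, hgen i⟩).ae_eq hΩ (hgen i), hzero i, hγ.one_le,
      hβ.one_le] with x h1 h2 g1 b1
    rw [h1]
    by_cases h0 : u x = 0
    · rw [h0, phiT_zero g1 b1, zero_mul, h2 h0]
    · exact mul_div_cancel₀ _ (phiT_pos g1 b1 h0).ne'
  have hS : MemS Ω γ β u := by
    refine ⟨memLp_one_iff_integrable.mp (Lp.memLp u), fun i => ⟨_, hgen i⟩,
      ENNReal.add_lt_top.mpr ⟨?_, ENNReal.sum_lt_top.mpr fun i _ => ?_⟩⟩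
    -- Since γ + β ≤ θ and Ω has finite measure, the bound |u|^{γ+β} ≤ 1 + |u|^θ suffices.
    · have hle : ∫⁻ x in Ω, ENNReal.ofReal (|u x| ^ (γ x + β x)) ≤
          ∫⁻ x in Ω, (ENNReal.ofReal 1 + ENNReal.ofReal (|u x| ^ θ x)) := by
        refine lintegral_mono_ae ?_
        filter_upwards [hgap, hγ.one_le, hβ.one_le] with x h1 g1 b1
        rw [← ENNReal.ofReal_add zero_le_one (by positivity)]
        refine ENNReal.ofReal_le_ofReal ?_
        rcases le_total |u x| 1 with h | h
        · have := Real.rpow_le_one (abs_nonneg _) h (by linarith : 0 ≤ γ x + β x)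
          have : 0 ≤ |u x| ^ θ x := by positivity
          linarith
        · have := Real.rpow_le_rpow_of_exponent_le h h1
          linarith
      refine hle.trans_lt ?_
      rw [lintegral_add_left measurable_const]
      refine ENNReal.add_lt_top.mpr ⟨?_, hθu⟩
      simpa [lt_top_iff_ne_top] using hfin
    · refine lt_of_le_of_lt (lintegral_mono_ae ?_) (hwmod i)
      filter_upwards [hWu i, hγ.one_le, hβ.one_le] with x h1 g1 b1
      refine ENNReal.ofReal_le_ofReal ?_
      rw [rpow_mul_rpow_eq b1, ← h1]
      refine Real.rpow_le_rpow (abs_nonneg _) ?_ (by linarith)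
      have h0 : 0 ≤ |u x| ^ (γ x / β x) := by positivity
      rw [abs_mul, abs_mul, abs_of_nonneg h0, abs_of_nonneg (h0.trans (rpow_le_phiT g1 b1 _))]
      exact mul_le_mul_of_nonneg_right (rpow_le_phiT g1 b1 _) (abs_nonneg _)
  refine ⟨⟨u, hS, hum, hθu⟩, ?_⟩
  have htot : Filter.Tendsto (fun m => luxNorm Ω (psi γ β θ)
      (fun x => phi γ β x ((U m).toFun x) - v x) + ∑ i, luxNorm Ω β (fun x =>
        phiT γ β x ((U m).toFun x) * genPartial Ω (U m).toFun i x - w i x)) Filter.atTop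
      (nhds (0 + ∑ _i : Fin n, 0)) :=
    hv.add (tendsto_finsetSum _ fun i _ => hw i)
  rw [Finset.sum_const_zero, add_zero] at htot
  refine htot.congr fun m => ?_
  refine congrArg₂ (· + ·) (luxNorm_congr ?_)
    (Finset.sum_congr rfl fun i _ => luxNorm_congr ?_)
  · filter_upwards [hφu] with x hx
    exact congrArg (phi γ β x ((U m).toFun x) - ·) hx.symm
  · filter_upwards [hWu i] with x hx
    exact congrArg (phiT γ β x ((U m).toFun x) * genPartial Ω (U m).toFun i x - ·) hx.symm

end SSpace

end VarExp

theorem corollary3p9 {n : ℕ} (hn : 2 ≤ n) (Ω : Set (VarExp.E n)) (hopen : IsOpen Ω)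
    (hconn : IsConnected Ω) (hbdd : Bornology.IsBounded Ω) (γ β θ : VarExp.E n → ℝ)
    (hγ : VarExp.IsExponent Ω γ) (hβ : VarExp.IsExponent Ω β) (hθ : VarExp.IsExponent Ω θ)
    (hγ1 : VarExp.IsC1Closure Ω γ) (hβ1 : VarExp.IsC1Closure Ω β)
    (hgap : ∃ ε₀ : ℝ, 0 < ε₀ ∧ ∀ᵐ x ∂volume.restrict Ω, γ x + β x + ε₀ ≤ θ x) :
    ∃ m : MetricSpace (VarExp.SSpace Ω γ β θ),
      (∀ u v : VarExp.SSpace Ω γ β θ,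
        VarExp.dS u v < ⊤ ∧ m.dist u v = (VarExp.dS u v).toReal) ∧
      @CompleteSpace (VarExp.SSpace Ω γ β θ) m.toUniformSpace := by
  obtain ⟨ε₀, hε₀, hgap⟩ := hgap
  have hgap' : ∀ᵐ x ∂volume.restrict Ω, γ x + β x ≤ θ x := hgap.mono fun x hx => by linarith
  have hψ : VarExp.IsExponent Ω (VarExp.psi γ β θ) := VarExp.isExponent_psi hγ hβ hθ hgap'
  have hfin : volume Ω ≠ ⊤ := hbdd.measure_lt_top.ne
  have hlt : ∀ u v : VarExp.SSpace Ω γ β θ, VarExp.dS u v < ⊤ := fun u v =>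
    u.dS_lt_top v hγ hβ hψ
  let m : MetricSpace (VarExp.SSpace Ω γ β θ) :=
    { dist := fun u v => (VarExp.dS u v).toReal
      dist_self := fun u => by
        rw [u.dS_self hβ hψ, ENNReal.toReal_zero]
      dist_comm := fun u v => by
        rw [u.dS_comm v]
      dist_triangle := fun u v w => by
        rw [← ENNReal.toReal_add (hlt u v).ne (hlt v w).ne]
        exact ENNReal.toReal_mono (ENNReal.add_lt_top.mpr ⟨hlt u v, hlt v w⟩).ne
          (u.dS_triangle v w hγ hβ hψ)
      eq_of_dist_eq_zero := fun {u v} h =>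
        VarExp.SSpace.eq_of_dS_eq_zero hfin hγ hβ hψ
          (((ENNReal.toReal_eq_zero_iff _).mp h).resolve_right (hlt u v).ne) }
  refine ⟨m, fun u v => ⟨hlt u v, rfl⟩, ?_⟩
  refine Metric.complete_of_cauchySeq_tendsto fun U hU => ?_
  obtain ⟨u, hu⟩ := VarExp.SSpace.exists_tendsto_dS hopen hfin hγ hβ hθ hγ1.contDiffOn
    hβ1.contDiffOn hgap' U fun ε hε => by
      obtain ⟨l, hl0, hl⟩ := ENNReal.lt_iff_exists_real_btwn.mp hε
      have hl1 : 0 < l := by simpa using hl.1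
      obtain ⟨N, hN⟩ := Metric.cauchySeq_iff.mp hU l hl1
      refine ⟨N, fun j hj k hk => lt_trans ?_ hl.2⟩
      exact (ENNReal.lt_ofReal_iff_toReal_lt (hlt _ _).ne).mpr (hN j hj k hk)
  refine ⟨u, tendsto_iff_dist_tendsto_zero.mpr ?_⟩
  exact (ENNReal.tendsto_toReal ENNReal.zero_ne_top).comp hu
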